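/- Let $(V_k,X_k,Z_k)_{k\ge 1}$ be i.i.d. random elements of $\mathbb R\times\mathcal X\times\mathcal Z$ ($\mathcal X,\mathcal Z$ measurable spaces) with $V_1$ integrable, let $\Theta\subset\mathbb R^q$ be open, $\beta_0\in\Theta$, and let $\mu:\Theta\times\mathcal Z\to\mathbb R$ and $A:\Theta\times\mathcal Z\to\mathbb R^q$ be measurable in $z$, with $E(V_1\mid Z_1)=\mu(\beta_0,Z_1)$ almost surely. Let $D$ be a real normed space (for instance a Banach space), $\delta:\mathcal X\to D$, $x\mapsto\delta_x$, a map, $F_n=\frac1n\sum_{k=1}^n\delta_{X_k}$, $\phi$ a real functional on $D$ (only its behaviour near the following $F$ matters), and $F\in D$. Assume: (a) $\|F-F_n\|_D=o_p(n^{-1/4})$, and there is $0<c<\infty$ with $\|\delta_x\|_D\le c$ for all $x\in\mathcal X$; (b) $\phi$ is twice Fréchet differentiable in a neighborhood of $F$, and $\phi''$ is Lipschitz continuous in a neighborhood of $F$; (c) with the influence functions $\dot\phi(x)=\phi'_F(\delta_x-F)$ and $\ddot\phi(x,y)=\phi''_F(\delta_x-F,\delta_y-F)$, which are assumed to be measurable,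 $E(\dot\phi(X_1)\mid Z_1)=E(V_1\mid Z_1)-\phi(F)$ almost surely; (d) $\beta\mapsto A(\beta,z)$ and $\beta\mapsto\mu(\beta,z)$ are continuous on $\Theta$ for all $z\in\mathcal Z$; (e) $A(\beta,Z_1)$ and $A(\beta,Z_1)\mu(\beta,Z_1)$ are dominated square integrable in a neighborhood of $\beta_0$, that is, for $f=A$ and for $f=A\mu$ there are a neighborhood $N$ of $\beta_0$ and a function $H$ with $E(H(Z_1)^2)<\infty$ such that, almost surely, $\|f(\beta,Z_1)\|\le H(Z_1)$ for all $\beta\in N$; (f) $\hat\beta_n\xrightarrow{p}\beta_0$ as $n\to\infty$. Let $a^{\otimes2}=aa^T$ and $$\hat\Sigma^{PV}_n=\frac1n\sum_{k=1}^n\Big(A(\hat\beta_n,Z_k)\big(\phi(F_n)+\phi'_{F_n}(\delta_{X_k}-F_n)-\mu(\hat\beta_n,Z_k)\big)+\hat h_1(X_k)\Big)^{\otimes2},$$ $$\hat h_1(x)=\frac1n\sum_{j=1}^nA(\hat\beta_n,Z_j)\,\phi''_{F_n}(\delta_x-F_n,\delta_{X_j}-F_n).$$ Then, as $n\to\infty$,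 $\hat\Sigma^{PV}_n\xrightarrow{p}\Sigma$, where $$\Sigma=\mathrm{Cov}\Big(A(\beta_0,Z_1)\big(\phi(F)+\dot\phi(X_1)-\mu(\beta_0,Z_1)\big)+E\big(A(\beta_0,Z_2)\,\ddot\phi(X_2,X_1)\mid X_1\big)\Big).$$ -/

import Mathlib

open MeasureTheory ProbabilityTheory Filter Topology

noncomputable section

namespace PseudoObs

/-- The sample average `F_n = n⁻¹ ∑_{k ≤ n} δ_{X_k}` (the observations are indexed from `0`). -/
def sampleMean {Ω 𝒳 D : Type*} [NormedAddCommGroup D] [NormedSpace ℝ D]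
    (δ : 𝒳 → D) (X : ℕ → Ω → 𝒳) (n : ℕ) (ω : Ω) : D :=
  (n : ℝ)⁻¹ • ∑ k ∈ Finset.range n, δ (X k ω)

/-- `φ'_G(δ_x - G)`. At `G = F` this is the first-order influence function. -/
def infl₁ {𝒳 D : Type*} [NormedAddCommGroup D] [NormedSpace ℝ D]
    (φ : D → ℝ) (δ : 𝒳 → D) (G : D) (x : 𝒳) : ℝ :=
  fderiv ℝ φ G (δ x - G)

/-- `φ''_G(δ_x - G, δ_y - G)`. At `G = F` this is the second-order influence function. -/
def infl₂ {𝒳 D : Type*} [NormedAddCommGroup D] [NormedSpace ℝ D]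
    (φ : D → ℝ) (δ : 𝒳 → D) (G : D) (x y : 𝒳) : ℝ :=
  fderiv ℝ (fderiv ℝ φ) G (δ x - G) (δ y - G)

/-- `φ` is twice Fréchet differentiable in a neighbourhood of `F`, and the second derivative is
Lipschitz continuous (for the operator norm) in a neighbourhood of `F`. -/
def TwiceDiffLipschitzNear {D : Type*} [NormedAddCommGroup D] [NormedSpace ℝ D]
    (φ : D → ℝ) (F : D) : Prop :=
  (∀ᶠ G in 𝓝 F, DifferentiableAt ℝ φ G ∧ DifferentiableAt ℝ (fderiv ℝ φ) G) ∧
    ∃ K : NNReal, ∃ U ∈ 𝓝 F, LipschitzOnWith K (fderiv ℝ (fderiv ℝ φ)) U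

/-- `f(β, Z)`, with `Z` of law `ν`, is dominated square integrable in a neighbourhood of `β₀`:
near `β₀` it is bounded in norm by one square integrable function of `Z`. -/
def DominatedSqIntegrableNear {B 𝒵 E : Type*} [TopologicalSpace B] [MeasurableSpace 𝒵]
    [NormedAddCommGroup E] (f : B → 𝒵 → E) (ν : Measure 𝒵) (β₀ : B) : Prop :=
  ∃ N ∈ 𝓝 β₀, ∃ H : 𝒵 → ℝ, MemLp H 2 ν ∧ ∀ᵐ z ∂ν, ∀ β ∈ N, ‖f β z‖ ≤ H z

/-- `ĥ₁(x) = n⁻¹ ∑_j φ''_{F_n}(δ_x - F_n, δ_{X_j} - F_n) A(β, Z_j)`, computed at the parameter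
value `β`. -/
def hHat {Ω 𝒳 𝒵 D : Type*} [NormedAddCommGroup D] [NormedSpace ℝ D] {q : ℕ}
    (φ : D → ℝ) (δ : 𝒳 → D)
    (A : EuclideanSpace ℝ (Fin q) → 𝒵 → EuclideanSpace ℝ (Fin q))
    (X : ℕ → Ω → 𝒳) (Z : ℕ → Ω → 𝒵) (n : ℕ) (ω : Ω)
    (β : EuclideanSpace ℝ (Fin q)) (x : 𝒳) : EuclideanSpace ℝ (Fin q) :=
  (n : ℝ)⁻¹ • ∑ j ∈ Finset.range n,
    infl₂ φ δ (sampleMean δ X n ω) x (X j ω) • A β (Z j ω)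

/-- The plug-in estimator
`n⁻¹ ∑_k (A(β̂_n, Z_k)(φ(F_n) + φ'_{F_n}(δ_{X_k} - F_n) - μ(β̂_n, Z_k)) + ĥ₁(X_k))^{⊗2}`. -/
def sigmaPV {Ω 𝒳 𝒵 D : Type*} [NormedAddCommGroup D] [NormedSpace ℝ D] {q : ℕ}
    (φ : D → ℝ) (δ : 𝒳 → D)
    (A : EuclideanSpace ℝ (Fin q) → 𝒵 → EuclideanSpace ℝ (Fin q))
    (μ : EuclideanSpace ℝ (Fin q) → 𝒵 → ℝ)
    (X : ℕ → Ω → 𝒳) (Z : ℕ → Ω → 𝒵) (βhat : ℕ → Ω → EuclideanSpace ℝ (Fin q))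
    (n : ℕ) (ω : Ω) : Matrix (Fin q) (Fin q) ℝ :=
  (n : ℝ)⁻¹ • ∑ k ∈ Finset.range n,
    let a : EuclideanSpace ℝ (Fin q) :=
      (φ (sampleMean δ X n ω) + infl₁ φ δ (sampleMean δ X n ω) (X k ω)
          - μ (βhat n ω) (Z k ω)) • A (βhat n ω) (Z k ω)
        + hHat φ δ A X Z n ω (βhat n ω) (X k ω)
    Matrix.vecMulVec a.ofLp a.ofLp

/-- The random vector
`A(β₀, Z₁)(φ(F) + φ̇(X₁) - μ(β₀, Z₁)) + E(A(β₀, Z₂) φ̈(X₂, X₁) | X₁)`;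
the two independent copies carry the indices `0` and `1`. -/
def scoreVec {Ω 𝒳 𝒵 D : Type*} [MeasurableSpace Ω] [MeasurableSpace 𝒳]
    [NormedAddCommGroup D] [NormedSpace ℝ D] {q : ℕ}
    (P : Measure Ω) (φ : D → ℝ) (δ : 𝒳 → D) (F : D)
    (A : EuclideanSpace ℝ (Fin q) → 𝒵 → EuclideanSpace ℝ (Fin q))
    (μ : EuclideanSpace ℝ (Fin q) → 𝒵 → ℝ) (β₀ : EuclideanSpace ℝ (Fin q))
    (X : ℕ → Ω → 𝒳) (Z : ℕ → Ω → 𝒵) (ω : Ω) : EuclideanSpace ℝ (Fin q) :=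
  (φ F + infl₁ φ δ F (X 0 ω) - μ β₀ (Z 0 ω)) • A β₀ (Z 0 ω)
    + (P[fun ω' => infl₂ φ δ F (X 1 ω') (X 0 ω') • A β₀ (Z 1 ω') |
        MeasurableSpace.comap (X 0) inferInstance]) ω

/-- The meat matrix `Σ`: the covariance matrix of `scoreVec`. -/
def sigma {Ω 𝒳 𝒵 D : Type*} [MeasurableSpace Ω] [MeasurableSpace 𝒳]
    [NormedAddCommGroup D] [NormedSpace ℝ D] {q : ℕ}
    (P : Measure Ω) (φ : D → ℝ) (δ : 𝒳 → D) (F : D)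
    (A : EuclideanSpace ℝ (Fin q) → 𝒵 → EuclideanSpace ℝ (Fin q))
    (μ : EuclideanSpace ℝ (Fin q) → 𝒵 → ℝ) (β₀ : EuclideanSpace ℝ (Fin q))
    (X : ℕ → Ω → 𝒳) (Z : ℕ → Ω → 𝒵) : Matrix (Fin q) (Fin q) ℝ :=
  Matrix.of fun i j =>
    cov[fun ω => scoreVec P φ δ F A μ β₀ X Z ω i, fun ω => scoreVec P φ δ F A μ β₀ X Z ω j; P]

end PseudoObs

end

namespace PseudoObs

open scoped ENNReal

/-! Let `a k` be the vector whose outer square enters the estimator (`pvTerm`), and `b k` the score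
at the truth evaluated at `(X k, Z k)` (`scoreFun` with correction `scoreCorr`). Everything reduces
to showing that the average of `‖a k - b k‖ ^ 2` tends to zero in probability. By Cauchy–Schwarz the
averages of outer products of `a` and of `b` then have the same limit, which the law of large
numbers identifies as the second moment matrix of the score. The score has mean zero, so this matrix
is its covariance.

The difference `a k - b k` has three sources. Replacing `F_n` by `F` costs at most a modulus `ρ
(F_n)`, uniformly in the observations because the `δ x` are bounded (`exists_modulus`). Replacing
`β̂_n` by `β₀` in `A` and in `μ • A` is controlled by the supremum of the oscillation over a small
ball, whose integral tends to zero by dominated convergence (`tendsto_avg_norm_sub_sq`). What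
remains is an average over `j` of `φ̈(X_j, X_k) A(β₀, Z_j)` minus its projection on `X_k`; its
summands are orthogonal in L², so its mean square is of order `1 / n`
(`tendsto_avg_norm_sub_kernelProj_sq`).

For the mean of the score, the first-order part vanishes by conditioning on `Z`. The second-order
part vanishes because `φ̈(x, X)` is centred for each `x`: a continuous linear functional of `F_n -
F` is an average of i.i.d. bounded variables and tends to zero (`integral_clm_comp_sub_eq_zero`). -/

/-- The filter on `ℕ × Ω` of the sets whose `n`-th sections have (outer) probability tending to
one. Convergence along it to a constant is convergence in probability. -/
def inProb {Ω : Type*} [MeasurableSpace Ω] (P : Measure Ω) : Filter (ℕ × Ω) where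
  sets := {s | Tendsto (fun n : ℕ => P {ω | (n, ω) ∉ s}) atTop (𝓝 0)}
  univ_sets := by simp
  sets_of_superset := by
    intro s t hs hst
    refine tendsto_of_tendsto_of_tendsto_of_le_of_le tendsto_const_nhds hs
      (fun _ => zero_le) fun n => measure_mono fun ω h h' => h (hst h')
  inter_sets := by
    intro s t hs ht
    have := Tendsto.add hs ht
    rw [add_zero] at this
    refine tendsto_of_tendsto_of_tendsto_of_le_of_le tendsto_const_nhds this
      (fun _ => zero_le) fun n => (measure_mono fun ω h => ?_).trans (measure_union_le _ _)
    simp only [Set.mem_inter_iff, Set.mem_ofPred_eq, not_and_or] at h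
    exact h

/-! ### Convergence in probability as a limit along a filter. -/

section inProb

variable {Ω : Type*} [MeasurableSpace Ω] {P : Measure Ω}

theorem eventually_inProb {p : ℕ × Ω → Prop} :
    (∀ᶠ x in inProb P, p x) ↔ Tendsto (fun n : ℕ => P {ω | ¬ p (n, ω)}) atTop (𝓝 0) :=
  Iff.rfl

/-- Gives access to squeezing, sums, products and continuous mappings of filter limits. Outer
probabilities suffice, so neither the parameter estimates nor the sample averages in `D` have to be
measurable. -/
theorem tendstoInMeasure_const_iff {E : Type*} [PseudoMetricSpace E] {f : ℕ → Ω → E} {c : E} :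
    TendstoInMeasure P f atTop (fun _ => c) ↔
      Tendsto (fun x : ℕ × Ω => f x.1 x.2) (inProb P) (𝓝 c) := by
  rw [tendstoInMeasure_iff_dist, Metric.tendsto_nhds]
  simp only [eventually_inProb, not_lt]

theorem tendsto_fst_inProb : Tendsto (Prod.fst : ℕ × Ω → ℕ) (inProb P) atTop := by
  rw [tendsto_atTop]
  intro N
  rw [eventually_inProb]
  refine tendsto_const_nhds.congr' ?_
  filter_upwards [eventually_ge_atTop N] with n hn
  simp [hn]

/-- Convergence in L¹ implies convergence in measure. -/
theorem tendsto_inProb_of_integral [IsFiniteMeasure P] {f : ℕ → Ω → ℝ}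
    (hf : ∀ n ω, 0 ≤ f n ω) (hint : ∀ n, Integrable (f n) P)
    (h : Tendsto (fun n => ∫ ω, f n ω ∂P) atTop (𝓝 0)) :
    Tendsto (fun x : ℕ × Ω => f x.1 x.2) (inProb P) (𝓝 0) := by
  rw [← tendstoInMeasure_const_iff]
  refine tendstoInMeasure_of_tendsto_eLpNorm (p := 1) one_ne_zero
    (fun n => (hint n).aestronglyMeasurable) aestronglyMeasurable_const ?_
  have h2 : ∀ n, eLpNorm (f n - fun _ => 0) 1 P = ENNReal.ofReal (∫ ω, f n ω ∂P) := by
    intro n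
    rw [eLpNorm_one_eq_lintegral_enorm,
      ofReal_integral_eq_lintegral_ofReal (hint n) (ae_of_all _ (hf n))]
    refine lintegral_congr fun ω => ?_
    simp [Real.enorm_of_nonneg (hf n ω)]
  simp only [h2]
  simpa using ENNReal.tendsto_ofReal h

end inProb

/-- The average of the first `n` terms of a sequence. -/
noncomputable def avg {E : Type*} [AddCommGroup E] [Module ℝ E] (n : ℕ) (f : ℕ → E) : E :=
  (n : ℝ)⁻¹ • ∑ k ∈ Finset.range n, f k

/-! ### Law of large numbers and mean squares of degenerate double averages. -/

section iid

variable {Ω 𝒴 : Type*} [MeasurableSpace Ω] [MeasurableSpace 𝒴] {P : Measure Ω}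
  [IsProbabilityMeasure P] {Y : ℕ → Ω → 𝒴}

theorem tendsto_avg_integral
    (hindep : iIndepFun Y P) (hident : ∀ k, IdentDistrib (Y k) (Y 0) P P)
    {u : 𝒴 → ℝ} (hu : Measurable u) (hint : Integrable (fun ω => u (Y 0 ω)) P) :
    Tendsto (fun x : ℕ × Ω => avg x.1 fun k => u (Y k x.2)) (inProb P)
      (𝓝 (∫ ω, u (Y 0 ω) ∂P)) := by
  have hid : ∀ k, IdentDistrib (fun ω => u (Y k ω)) (fun ω => u (Y 0 ω)) P P :=
    fun k => (hident k).comp hu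
  have hpair : Pairwise fun i j => IndepFun (fun ω => u (Y i ω)) (fun ω => u (Y j ω)) P :=
    fun i j hij => (hindep.indepFun hij).comp hu hu
  have hae := strong_law_ae (fun k ω => u (Y k ω)) hint hpair hid
  have hm : ∀ n, AEStronglyMeasurable (fun ω => avg n fun k => u (Y k ω)) P := by
    intro n
    have h : AEStronglyMeasurable (fun ω => ∑ k ∈ Finset.range n, u (Y k ω)) P :=
      Finset.aestronglyMeasurable_fun_sum _ fun k _ =>
        ((hid k).integrable_iff.2 hint).aestronglyMeasurable
    exact h.const_smul (n : ℝ)⁻¹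
  have hT : TendstoInMeasure P (fun n ω => avg n fun k => u (Y k ω)) atTop
      (fun _ => ∫ ω, u (Y 0 ω) ∂P) :=
    tendstoInMeasure_of_tendsto_ae hm hae
  exact (tendstoInMeasure_const_iff (f := fun n ω => avg n fun k => u (Y k ω))).1 hT

/-- Fubini for the product law: for fixed `W` the inner integral over `Y` vanishes. Joint
integrability is not required, since otherwise the integral is zero by convention. -/
theorem integral_inner_eq_zero_of_integral_eq_zero {𝒲 E : Type*} [MeasurableSpace 𝒲]
    [NormedAddCommGroup E] [InnerProductSpace ℝ E] [CompleteSpace E]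
    {W : Ω → 𝒲} {Y : Ω → 𝒴} (hW : Measurable W) (hY : Measurable Y) (h : IndepFun W Y P)
    {u : 𝒲 → E} {g : 𝒲 × 𝒴 → E} (hu : StronglyMeasurable u) (hg : StronglyMeasurable g)
    (hgi : ∀ w, Integrable (fun y => g (w, y)) (P.map Y))
    (hg0 : ∀ w, ∫ y, g (w, y) ∂(P.map Y) = 0) :
    ∫ ω, inner ℝ (u (W ω)) (g (W ω, Y ω)) ∂P = 0 := by
  have := Measure.isProbabilityMeasure_map (μ := P) hW.aemeasurable
  have := Measure.isProbabilityMeasure_map (μ := P) hY.aemeasurable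
  have hlaw := (indepFun_iff_map_prod_eq_prod_map_map hW.aemeasurable hY.aemeasurable).1 h
  set k : 𝒲 × 𝒴 → ℝ := fun p => inner ℝ (u p.1) (g p) with hk
  have hkm : StronglyMeasurable k := (hu.comp_measurable measurable_fst).inner hg
  have : ∫ ω, inner ℝ (u (W ω)) (g (W ω, Y ω)) ∂P
      = ∫ p, k p ∂((P.map W).prod (P.map Y)) := by
    rw [← hlaw, integral_map (hW.prodMk hY).aemeasurable hkm.aestronglyMeasurable]
  rw [this]
  by_cases hi : Integrable k ((P.map W).prod (P.map Y))
  · rw [integral_prod _ hi]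
    refine integral_eq_zero_of_ae (ae_of_all _ fun w => ?_)
    simp only [hk]
    rw [integral_inner (hgi w), hg0, inner_zero_right]
    rfl
  · exact integral_undef hi

/-- The summands are orthogonal. Of two distinct indices `j`, `l`, at least one differs from `k`;
the corresponding variable is independent of the other two and integrates to zero in the first slot
of `G`. Only the `n` diagonal terms survive. The term `j = k` need not be centred. -/
theorem integral_norm_sum_sq_le {E : Type*}
    [NormedAddCommGroup E] [InnerProductSpace ℝ E] [CompleteSpace E]
    (hYm : ∀ k, Measurable (Y k))
    (hindep : iIndepFun Y P) (hident : ∀ k, IdentDistrib (Y k) (Y 0) P P)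
    {G : 𝒴 × 𝒴 → E} (hG : StronglyMeasurable G) {b : 𝒴 → ℝ} (hb : MemLp b 2 (P.map (Y 0)))
    (hGb : ∀ y y', ‖G (y', y)‖ ≤ b y') (hG0 : ∀ y, ∫ y', G (y', y) ∂(P.map (Y 0)) = 0)
    (n k : ℕ) :
    Integrable (fun ω => ‖∑ j ∈ Finset.range n, G (Y j ω, Y k ω)‖ ^ 2) P ∧
    ∫ ω, ‖∑ j ∈ Finset.range n, G (Y j ω, Y k ω)‖ ^ 2 ∂P
      ≤ n * ∫ y, b y ^ 2 ∂(P.map (Y 0)) := by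
  have hlaw : ∀ j, P.map (Y j) = P.map (Y 0) := fun j => (hident j).map_eq
  have hbj : ∀ j, MemLp (fun ω => b (Y j ω)) 2 P := fun j => by
    rw [← hlaw j] at hb
    exact hb.comp_of_map (hYm j).aemeasurable
  have hGm : ∀ j, AEStronglyMeasurable (fun ω => G (Y j ω, Y k ω)) P := fun j =>
    (hG.comp_measurable ((hYm j).prodMk (hYm k))).aestronglyMeasurable
  have hξ : ∀ j, MemLp (fun ω => G (Y j ω, Y k ω)) 2 P := fun j =>
    (hbj j).mono (hGm j) (ae_of_all _ fun ω => (hGb _ _).trans (le_abs_self _))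
  refine ⟨(memLp_finsetSum _ fun j _ => hξ j).integrable_norm_pow two_ne_zero, ?_⟩
  have hprod : ∀ j l, Integrable
      (fun ω => inner ℝ (G (Y j ω, Y k ω)) (G (Y l ω, Y k ω)) : Ω → ℝ) P :=
    fun j l => ((hξ j).norm.integrable_mul (hξ l).norm).mono' ((hGm j).inner (hGm l))
      (ae_of_all _ fun ω => norm_inner_le_norm _ _)
  have hGi : ∀ y, Integrable (fun y' => G (y', y)) (P.map (Y 0)) := fun y => by
    have := Measure.isProbabilityMeasure_map (μ := P) (hYm 0).aemeasurable
    refine (hb.integrable one_le_two).mono' ?_ (ae_of_all _ fun y' => hGb y y')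
    exact (hG.comp_measurable (measurable_id.prodMk measurable_const)).aestronglyMeasurable
  have hright : ∀ j l, l ≠ j → l ≠ k →
      ∫ ω, inner ℝ (G (Y j ω, Y k ω)) (G (Y l ω, Y k ω)) ∂P = 0 := by
    intro j l hj hk
    refine integral_inner_eq_zero_of_integral_eq_zero (W := fun ω => (Y j ω, Y k ω)) (Y := Y l)
      (u := G) (g := fun p => G (p.2, p.1.2)) ((hYm j).prodMk (hYm k)) (hYm l)
      (hindep.indepFun_prodMk hYm j k l hj.symm hk.symm) hG
      (hG.comp_measurable (measurable_snd.prodMk (measurable_snd.comp measurable_fst))) ?_ ?_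
    · intro w
      rw [hlaw]
      exact hGi w.2
    · intro w
      rw [hlaw]
      exact hG0 w.2
  have hzero : ∀ j l, j ≠ l → ∫ ω, inner ℝ (G (Y j ω, Y k ω)) (G (Y l ω, Y k ω)) ∂P = 0 := by
    intro j l hjl
    -- If `l = k` then `j` is the index that is free, and the inner product is read the other way
    -- round.
    by_cases hlk : l = k
    · rw [← hright l j hjl (hlk ▸ hjl)]
      exact integral_congr_ae (ae_of_all _ fun ω => real_inner_comm _ _)
    · exact hright j l hjl.symm hlk
  calc ∫ ω, ‖∑ j ∈ Finset.range n, G (Y j ω, Y k ω)‖ ^ 2 ∂P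
      = ∑ j ∈ Finset.range n, ∑ l ∈ Finset.range n,
          ∫ ω, inner ℝ (G (Y j ω, Y k ω)) (G (Y l ω, Y k ω)) ∂P := by
        simp_rw [← real_inner_self_eq_norm_sq, sum_inner, inner_sum]
        rw [integral_finsetSum _ fun j _ => integrable_finsetSum _ fun l _ => hprod j l]
        exact Finset.sum_congr rfl fun j _ => integral_finsetSum _ fun l _ => hprod j l
    _ = ∑ j ∈ Finset.range n, ∫ ω, ‖G (Y j ω, Y k ω)‖ ^ 2 ∂P := by
        refine Finset.sum_congr rfl fun j hj => ?_
        rw [Finset.sum_eq_single_of_mem j hj fun l _ hl => hzero j l hl.symm]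
        simp_rw [real_inner_self_eq_norm_sq]
    _ ≤ ∑ j ∈ Finset.range n, ∫ y, b y ^ 2 ∂(P.map (Y 0)) := by
        refine Finset.sum_le_sum fun j _ => ?_
        rw [← hlaw j, integral_map (hYm j).aemeasurable
          (by rw [hlaw j]; exact (hb.aestronglyMeasurable.pow 2))]
        refine integral_mono ((hξ j).integrable_norm_pow two_ne_zero) (hbj j).integrable_sq
          fun ω => ?_
        have := hGb (Y k ω) (Y j ω)
        dsimp only
        gcongr
    _ = n * ∫ y, b y ^ 2 ∂(P.map (Y 0)) := by simp

/-- Dividing the preceding bound by `n ^ 2` makes every summand, and hence the outer average, at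
most `S / n` in expectation. -/
theorem tendsto_avg_norm_avg_sq {E : Type*}
    [NormedAddCommGroup E] [InnerProductSpace ℝ E] [CompleteSpace E]
    (hYm : ∀ k, Measurable (Y k))
    (hindep : iIndepFun Y P) (hident : ∀ k, IdentDistrib (Y k) (Y 0) P P)
    {G : 𝒴 × 𝒴 → E} (hG : StronglyMeasurable G) {b : 𝒴 → ℝ} (hb : MemLp b 2 (P.map (Y 0)))
    (hGb : ∀ y y', ‖G (y', y)‖ ≤ b y') (hG0 : ∀ y, ∫ y', G (y', y) ∂(P.map (Y 0)) = 0) :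
    Tendsto (fun x : ℕ × Ω => avg x.1 fun k =>
      ‖avg x.1 fun j => G (Y j x.2, Y k x.2)‖ ^ 2) (inProb P) (𝓝 0) := by
  have key := integral_norm_sum_sq_le hYm hindep hident hG hb hGb hG0
  set S := ∫ y, b y ^ 2 ∂(P.map (Y 0)) with hS
  have heq : ∀ n k ω, ‖avg n fun j => G (Y j ω, Y k ω)‖ ^ 2
      = ((n : ℝ)⁻¹) ^ 2 * ‖∑ j ∈ Finset.range n, G (Y j ω, Y k ω)‖ ^ 2 := by
    intro n k ω
    rw [avg, norm_smul, mul_pow, Real.norm_eq_abs, sq_abs]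
  have hi : ∀ n k, Integrable (fun ω => ‖avg n fun j => G (Y j ω, Y k ω)‖ ^ 2) P := by
    intro n k
    simp_rw [heq]
    exact (key n k).1.const_mul _
  refine tendsto_inProb_of_integral
    (f := fun n ω => avg n fun k => ‖avg n fun j => G (Y j ω, Y k ω)‖ ^ 2) ?_ ?_ ?_
  · intro n ω
    exact smul_nonneg (by positivity) (Finset.sum_nonneg fun k _ => by positivity)
  · intro n
    exact (integrable_finsetSum _ fun k _ => hi n k).smul (n : ℝ)⁻¹
  · have hup : Tendsto (fun n : ℕ => (n : ℝ)⁻¹ * S) atTop (𝓝 0) := by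
      simpa using (tendsto_inv_atTop_nhds_zero_nat (𝕜 := ℝ)).mul_const S
    refine tendsto_of_tendsto_of_tendsto_of_le_of_le tendsto_const_nhds hup
      (fun n => integral_nonneg fun ω =>
        smul_nonneg (by positivity) (Finset.sum_nonneg fun k _ => by positivity)) fun n => ?_
    simp only [avg] at hi ⊢
    rw [integral_smul, integral_finsetSum _ fun k _ => hi n k]
    have hle : ∀ k ∈ Finset.range n,
        ∫ ω, ‖avg n fun j => G (Y j ω, Y k ω)‖ ^ 2 ∂P ≤ ((n : ℝ)⁻¹) ^ 2 * (n * S) := by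
      intro k _
      simp_rw [heq]
      rw [integral_const_mul]
      exact mul_le_mul_of_nonneg_left (key n k).2 (by positivity)
    have := Finset.sum_le_sum hle
    simp only [Finset.sum_const, Finset.card_range, nsmul_eq_mul] at this
    rcases Nat.eq_zero_or_pos n with rfl | hn
    · simp
    · rw [smul_eq_mul]
      refine mul_le_mul_of_nonneg_left (this.trans_eq ?_) (by positivity)
      have : (n : ℝ) ≠ 0 := by positivity
      field_simp

end iid

/-! ### Replacing the estimated parameter by the true one inside averages. -/

section Oscillation

variable {B 𝒵 E : Type*} [PseudoMetricSpace B] [NormedAddCommGroup E]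

/-- The squared oscillation of `β ↦ f β z` around `β₀` on the ball of radius `r`. -/
noncomputable def sqOsc (f : B → 𝒵 → E) (β₀ : B) (r : ℝ) (z : 𝒵) : ℝ≥0∞ :=
  ⨆ β ∈ Metric.ball β₀ r, ‖f β z - f β₀ z‖ₑ ^ 2

theorem le_sqOsc (f : B → 𝒵 → E) {β₀ β : B} {r : ℝ} (hβ : β ∈ Metric.ball β₀ r) (z : 𝒵) :
    ‖f β z - f β₀ z‖ₑ ^ 2 ≤ sqOsc f β₀ r z :=
  le_iSup₂ (f := fun β _ => ‖f β z - f β₀ z‖ₑ ^ 2) β hβ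

/-- By continuity in `β`, the supremum over the ball equals the one over a countable dense subset.
-/
theorem measurable_sqOsc [MeasurableSpace 𝒵] [SecondCountableTopology B] [MeasurableSpace E]
    [BorelSpace E] [SecondCountableTopology E] {f : B → 𝒵 → E} {β₀ : B} {r : ℝ} (hr : 0 < r)
    (hfm : ∀ β ∈ Metric.ball β₀ r, Measurable (f β))
    (hfc : ∀ z, ContinuousOn (fun β => f β z) (Metric.ball β₀ r)) :
    Measurable (sqOsc f β₀ r) := by
  obtain ⟨T, hTc, hTd⟩ := TopologicalSpace.exists_countable_dense B
  set S := Metric.ball β₀ r ∩ T with hS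
  have hcl : Metric.ball β₀ r ⊆ closure S := hTd.open_subset_closure_inter Metric.isOpen_ball
  have heq : sqOsc f β₀ r = fun z => ⨆ β ∈ S, ‖f β z - f β₀ z‖ₑ ^ 2 := by
    funext z
    refine le_antisymm (iSup₂_le fun β hβ => ?_)
      (iSup₂_le fun β hβ => le_sqOsc f hβ.1 z)
    have hc : ContinuousOn (fun β => ‖f β z - f β₀ z‖ₑ ^ 2) (Metric.ball β₀ r) :=
      (ENNReal.continuous_pow 2).comp_continuousOn
        (continuous_enorm.comp_continuousOn ((hfc z).sub continuousOn_const))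
    have hw : ContinuousWithinAt (fun β => ‖f β z - f β₀ z‖ₑ ^ 2) S β :=
      (hc β hβ).mono Set.inter_subset_left
    have hmem := hw.mem_closure_image (hcl hβ)
    refine closure_minimal ?_ isClosed_Iic hmem
    rintro _ ⟨β', hβ', rfl⟩
    exact le_iSup₂ (f := fun β _ => ‖f β z - f β₀ z‖ₑ ^ 2) β' hβ'
  rw [heq]
  refine Measurable.biSup S (hTc.mono Set.inter_subset_right) fun β hβ => ?_
  exact (((hfm β hβ.1).sub (hfm β₀ (Metric.mem_ball_self hr))).enorm).pow_const 2

theorem tendsto_sqOsc {f : B → 𝒵 → E} {β₀ : B} {z : 𝒵}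
    (hfc : ContinuousAt (fun β => f β z) β₀) :
    Tendsto (fun r => sqOsc f β₀ r z) (𝓝[>] 0) (𝓝 0) := by
  rw [ENNReal.tendsto_nhds_zero]
  intro ε hε
  have h1 : Tendsto (fun β => ‖f β z - f β₀ z‖ₑ ^ 2) (𝓝 β₀) (𝓝 0) := by
    have h : ContinuousAt (fun β => ‖f β z - f β₀ z‖ₑ ^ 2) β₀ :=
      (ENNReal.continuous_pow 2).continuousAt.comp
        (continuous_enorm.continuousAt.comp (hfc.sub continuousAt_const))
    simpa [ContinuousAt] using h
  obtain ⟨r, hr, hball⟩ := Metric.eventually_nhds_iff_ball.1 (ENNReal.tendsto_nhds_zero.1 h1 ε hε)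
  filter_upwards [Ioo_mem_nhdsGT hr] with s hs
  exact iSup₂_le fun β hβ => hball β (Metric.ball_subset_ball hs.2.le hβ)

variable [MeasurableSpace 𝒵]

/-- Dominated convergence with majorant `(2 * H) ^ 2`: pointwise convergence is continuity at `β₀`.
-/
theorem tendsto_lintegral_sqOsc [SecondCountableTopology B] [MeasurableSpace E] [BorelSpace E]
    [SecondCountableTopology E] {ν : Measure 𝒵} {Θ : Set B} (hΘ : IsOpen Θ) {f : B → 𝒵 → E}
    {β₀ : B} (hβ₀ : β₀ ∈ Θ) (hfm : ∀ β ∈ Θ, Measurable (f β))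
    (hfc : ∀ z, ContinuousOn (fun β => f β z) Θ) (hdom : DominatedSqIntegrableNear f ν β₀) :
    Tendsto (fun r => ∫⁻ z, sqOsc f β₀ r z ∂ν) (𝓝[>] 0) (𝓝 0) := by
  obtain ⟨N, hN, H, hH, hfH⟩ := hdom
  obtain ⟨r, hr, hball⟩ := Metric.mem_nhds_iff.1 (inter_mem (hΘ.mem_nhds hβ₀) hN)
  have hlim := tendsto_lintegral_filter_of_dominated_convergence (μ := ν) (l := 𝓝[>] (0 : ℝ))
    (F := fun r z => sqOsc f β₀ r z) (f := fun _ => 0) (fun z => (2 * ‖H z‖ₑ) ^ 2) ?_ ?_ ?_ ?_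
  · simpa using hlim
  · filter_upwards [Ioo_mem_nhdsGT hr] with s hs
    have hsub : Metric.ball β₀ s ⊆ Θ := fun β hβ =>
      (hball (Metric.ball_subset_ball hs.2.le hβ)).1
    exact measurable_sqOsc hs.1 (fun β hβ => hfm β (hsub hβ)) fun z => (hfc z).mono hsub
  · filter_upwards [Ioo_mem_nhdsGT hr] with s hs
    filter_upwards [hfH] with z hz
    refine iSup₂_le fun β hβ => ?_
    have hle : ∀ β ∈ N, ‖f β z‖ₑ ≤ ‖H z‖ₑ := fun β hβ =>
      enorm_le_iff_norm_le.2 ((hz β hβ).trans (le_abs_self _))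
    gcongr
    rw [two_mul]
    exact (enorm_sub_le).trans (add_le_add
      (hle β (hball (Metric.ball_subset_ball hs.2.le hβ)).2) (hle β₀ (mem_of_mem_nhds hN)))
  · simp_rw [mul_pow]
    rw [lintegral_const_mul' _ _ (by simp)]
    refine ENNReal.mul_ne_top (by simp) ?_
    have := (lintegral_rpow_enorm_lt_top_of_eLpNorm_lt_top two_ne_zero (by simp) hH.2).ne
    simpa using this
  · exact ae_of_all _ fun z => tendsto_sqOsc ((hfc z).continuousAt (hΘ.mem_nhds hβ₀))

/-- The estimate depends on all the `Z k`, so it is removed by a supremum: once it lies in the ball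
of radius `r`, the average is at most that of `sqOsc f β₀ r (Z k)`, whose expectation does not
depend on `n ≥ 1` and is small for small `r`. -/
theorem tendsto_avg_norm_sub_sq [SecondCountableTopology B] [MeasurableSpace E] [BorelSpace E]
    [SecondCountableTopology E] {Ω : Type*} [MeasurableSpace Ω] {P : Measure Ω}
    {Z : ℕ → Ω → 𝒵} (hZm : ∀ k, Measurable (Z k)) (hlaw : ∀ k, P.map (Z k) = P.map (Z 0))
    {Θ : Set B} (hΘ : IsOpen Θ) {f : B → 𝒵 → E}
    {β₀ : B} (hβ₀ : β₀ ∈ Θ) (hfm : ∀ β ∈ Θ, Measurable (f β))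
    (hfc : ∀ z, ContinuousOn (fun β => f β z) Θ)
    (hdom : DominatedSqIntegrableNear f (P.map (Z 0)) β₀) {βhat : ℕ → Ω → B}
    (hβ : Tendsto (fun x : ℕ × Ω => βhat x.1 x.2) (inProb P) (𝓝 β₀)) :
    Tendsto (fun x : ℕ × Ω => avg x.1 fun k =>
      ‖f (βhat x.1 x.2) (Z k x.2) - f β₀ (Z k x.2)‖ ^ 2) (inProb P) (𝓝 0) := by
  have hlim := tendsto_lintegral_sqOsc hΘ hβ₀ hfm hfc hdom
  obtain ⟨r₀, hr₀, hball⟩ := Metric.isOpen_iff.1 hΘ β₀ hβ₀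
  have hnn : ∀ n ω, 0 ≤ avg n fun k => ‖f (βhat n ω) (Z k ω) - f β₀ (Z k ω)‖ ^ 2 := fun n ω =>
    smul_nonneg (by positivity) (Finset.sum_nonneg fun k _ => by positivity)
  rw [Metric.tendsto_nhds]
  intro ε hε
  have hε' : ENNReal.ofReal ε ≠ 0 := by simpa using hε
  rw [eventually_inProb, ENNReal.tendsto_nhds_zero]
  intro η hη
  have hIoo : ∀ᶠ r in 𝓝[>] (0 : ℝ), r ∈ Set.Ioo 0 r₀ := Ioo_mem_nhdsGT hr₀
  -- With this bound Markov's inequality at level `ε` yields `η / 2`; the other half is left for the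
  -- event that the estimate misses the ball.
  obtain ⟨r, hr, hI⟩ := (hIoo.and
    (ENNReal.tendsto_nhds_zero.1 hlim (η / 2 * ENNReal.ofReal ε)
      (ENNReal.mul_pos (ENNReal.half_pos hη.ne').ne' hε'))).exists
  have hsub : Metric.ball β₀ r ⊆ Θ := (Metric.ball_subset_ball hr.2.le).trans hball
  have hwm : Measurable (sqOsc f β₀ r) :=
    measurable_sqOsc hr.1 (fun β hβ => hfm β (hsub hβ)) fun z => (hfc z).mono hsub
  have hβr := ENNReal.tendsto_nhds_zero.1
    (eventually_inProb.1 (hβ.eventually (Metric.ball_mem_nhds β₀ hr.1))) (η / 2)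
      (ENNReal.half_pos hη.ne')
  filter_upwards [hβr, eventually_ge_atTop 1] with n hn hn1
  set W : Ω → ℝ≥0∞ := fun ω =>
    ENNReal.ofReal (n : ℝ)⁻¹ * ∑ k ∈ Finset.range n, sqOsc f β₀ r (Z k ω) with hW
  have hWm : Measurable W :=
    (Finset.measurable_fun_sum _ fun k _ => hwm.comp (hZm k)).const_mul _
  have hWint : ∫⁻ ω, W ω ∂P = ∫⁻ z, sqOsc f β₀ r z ∂(P.map (Z 0)) := by
    rw [hW, lintegral_const_mul' _ _ (by simp),
      lintegral_finsetSum (f := fun k ω => sqOsc f β₀ r (Z k ω)) _ fun k _ => hwm.comp (hZm k)]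
    have : ∀ k ∈ Finset.range n, ∫⁻ ω, sqOsc f β₀ r (Z k ω) ∂P
        = ∫⁻ z, sqOsc f β₀ r z ∂(P.map (Z 0)) := fun k _ => by
      rw [← hlaw k, lintegral_map hwm (hZm k)]
    rw [Finset.sum_congr rfl this, Finset.sum_const, Finset.card_range, nsmul_eq_mul, ← mul_assoc,
      ENNReal.ofReal_inv_of_pos (by positivity), ENNReal.ofReal_natCast,
      ENNReal.inv_mul_cancel (by simpa using Nat.one_le_iff_ne_zero.1 hn1) (by simp), one_mul]
  have hle : {ω | ¬ dist (avg n fun k => ‖f (βhat n ω) (Z k ω) - f β₀ (Z k ω)‖ ^ 2) 0 < ε}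
      ⊆ {ω | ¬ βhat n ω ∈ Metric.ball β₀ r} ∪ {ω | ENNReal.ofReal ε ≤ W ω} := by
    intro ω hω
    by_cases hb : βhat n ω ∈ Metric.ball β₀ r
    · right
      have hω' : ε ≤ avg n fun k => ‖f (βhat n ω) (Z k ω) - f β₀ (Z k ω)‖ ^ 2 := by
        have h := not_lt.1 hω
        rwa [Real.dist_eq, sub_zero, abs_of_nonneg (hnn n ω)] at h
      refine (ENNReal.ofReal_le_ofReal hω').trans ?_
      rw [avg, smul_eq_mul, ENNReal.ofReal_mul (by positivity),
        ENNReal.ofReal_sum_of_nonneg fun k _ => by positivity]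
      refine mul_le_mul_right (Finset.sum_le_sum fun k _ => ?_) _
      rw [ENNReal.ofReal_pow (norm_nonneg _), ofReal_norm]
      exact le_sqOsc f hb _
    · exact Or.inl hb
  calc P _ ≤ P {ω | ¬ βhat n ω ∈ Metric.ball β₀ r} + P {ω | ENNReal.ofReal ε ≤ W ω} :=
        (measure_mono hle).trans (measure_union_le _ _)
    _ ≤ η / 2 + η / 2 := by
        refine add_le_add hn ?_
        refine (meas_ge_le_lintegral_div hWm.aemeasurable hε' (by simp)).trans ?_
        rw [hWint]
        exact ENNReal.div_le_of_le_mul hI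
    _ = η := ENNReal.add_halves η

end Oscillation

/-! ### Continuity of the influence functions in the base point. -/

section Functional

variable {𝒳 D : Type*} [NormedAddCommGroup D] [NormedSpace ℝ D] {φ : D → ℝ} {F : D} {δ : 𝒳 → D}

theorem TwiceDiffLipschitzNear.isSymm (hφ : TwiceDiffLipschitzNear φ F) (v w : D) :
    fderiv ℝ (fderiv ℝ φ) F v w = fderiv ℝ (fderiv ℝ φ) F w v :=
  second_derivative_symmetric_of_eventually (f' := fderiv ℝ φ)
    (hφ.1.mono fun _ hG => hG.1.hasFDerivAt) hφ.1.self_of_nhds.2.hasFDerivAt v w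

theorem TwiceDiffLipschitzNear.infl₂_comm (hφ : TwiceDiffLipschitzNear φ F) (x y : 𝒳) :
    infl₂ φ δ F x y = infl₂ φ δ F y x :=
  hφ.isSymm _ _

theorem abs_infl₁_le {c : ℝ} (hδ : ∀ x, ‖δ x‖ ≤ c) (x : 𝒳) :
    |infl₁ φ δ F x| ≤ ‖fderiv ℝ φ F‖ * (c + ‖F‖) :=
  ((fderiv ℝ φ F).le_opNorm _).trans
    (by gcongr; exact (norm_sub_le _ _).trans (by gcongr; exact hδ x))

theorem abs_infl₂_le {c : ℝ} (hδ : ∀ x, ‖δ x‖ ≤ c) (x y : 𝒳) :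
    |infl₂ φ δ F x y| ≤ ‖fderiv ℝ (fderiv ℝ φ) F‖ * (c + ‖F‖) * (c + ‖F‖) :=
  ((fderiv ℝ (fderiv ℝ φ) F).le_opNorm₂ _ _).trans (by
    have h : ∀ x, ‖δ x - F‖ ≤ c + ‖F‖ := fun x => (norm_sub_le _ _).trans (by gcongr; exact hδ x)
    have h0 := (norm_nonneg _).trans (h x)
    gcongr
    exacts [h x, h y])

/-- Split `δ x - G = (δ x - F) - (G - F)`; what depends on `x` is bounded by `c + ‖F‖`. -/
theorem abs_add_infl₁_sub_le {c : ℝ} (hδ : ∀ x, ‖δ x‖ ≤ c) (G : D) (x : 𝒳) :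
    |(φ G + infl₁ φ δ G x) - (φ F + infl₁ φ δ F x)| ≤
      |φ G - φ F| + ‖fderiv ℝ φ G - fderiv ℝ φ F‖ * (c + ‖F‖) + ‖fderiv ℝ φ G‖ * ‖G - F‖ := by
  have h : ‖δ x - F‖ ≤ c + ‖F‖ := (norm_sub_le _ _).trans (by gcongr; exact hδ x)
  have heq : (φ G + infl₁ φ δ G x) - (φ F + infl₁ φ δ F x) = (φ G - φ F)
      + (fderiv ℝ φ G - fderiv ℝ φ F) (δ x - F) - fderiv ℝ φ G (G - F) := by
    simp only [infl₁, map_sub, sub_apply]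
    ring
  rw [heq]
  refine (abs_sub _ _).trans (add_le_add ((abs_add_le _ _).trans (add_le_add le_rfl ?_)) ?_)
  · exact ((fderiv ℝ φ G - fderiv ℝ φ F).le_opNorm _).trans (by gcongr)
  · exact (fderiv ℝ φ G).le_opNorm _

theorem abs_infl₂_sub_le {c : ℝ} (hδ : ∀ x, ‖δ x‖ ≤ c) (G : D) (x y : 𝒳) :
    |infl₂ φ δ G x y - infl₂ φ δ F x y| ≤
      ‖fderiv ℝ (fderiv ℝ φ) G - fderiv ℝ (fderiv ℝ φ) F‖ * (c + ‖G‖) * (c + ‖G‖)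
        + ‖fderiv ℝ (fderiv ℝ φ) F‖ * ‖G - F‖ * (c + ‖G‖)
        + ‖fderiv ℝ (fderiv ℝ φ) F‖ * (c + ‖F‖) * ‖G - F‖ := by
  have h : ∀ (G : D) x, ‖δ x - G‖ ≤ c + ‖G‖ :=
    fun G x => (norm_sub_le _ _).trans (by gcongr; exact hδ x)
  have h0 : ∀ G : D, 0 ≤ c + ‖G‖ := fun G => (norm_nonneg _).trans (h G x)
  have heq : infl₂ φ δ G x y - infl₂ φ δ F x y
      = (fderiv ℝ (fderiv ℝ φ) G - fderiv ℝ (fderiv ℝ φ) F) (δ x - G) (δ y - G)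
        - fderiv ℝ (fderiv ℝ φ) F (G - F) (δ y - G)
        - fderiv ℝ (fderiv ℝ φ) F (δ x - F) (G - F) := by
    simp only [infl₂, map_sub, sub_apply]
    ring
  rw [heq]
  refine (abs_sub _ _).trans (add_le_add ((abs_sub _ _).trans (add_le_add ?_ ?_)) ?_)
  · refine ((fderiv ℝ (fderiv ℝ φ) G - fderiv ℝ (fderiv ℝ φ) F).le_opNorm₂ _ _).trans ?_
    have := h0 G
    gcongr
    exacts [h G x, h G y]
  · refine ((fderiv ℝ (fderiv ℝ φ) F).le_opNorm₂ _ _).trans ?_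
    gcongr
    exact h G y
  · refine ((fderiv ℝ (fderiv ℝ φ) F).le_opNorm₂ _ _).trans ?_
    gcongr
    exact h F x

/-- The influence functions depend continuously on the base point, uniformly in the observations. -/
theorem TwiceDiffLipschitzNear.exists_modulus (hφ : TwiceDiffLipschitzNear φ F) {c : ℝ}
    (hδ : ∀ x, ‖δ x‖ ≤ c) :
    ∃ ρ : D → ℝ, Tendsto ρ (𝓝 F) (𝓝 0) ∧
      (∀ G x, |(φ G + infl₁ φ δ G x) - (φ F + infl₁ φ δ F x)| ≤ ρ G) ∧
      ∀ G x y, |infl₂ φ δ G x y - infl₂ φ δ F x y| ≤ ρ G := by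
  -- A point of `𝒳` is what forces `0 ≤ c`; without one all bounds are vacuous.
  rcases isEmpty_or_nonempty 𝒳 with hX | ⟨⟨x₀⟩⟩
  · exact ⟨0, tendsto_const_nhds, fun _ x => isEmptyElim x, fun _ x => isEmptyElim x⟩
  have hc : 0 ≤ c := (norm_nonneg _).trans (hδ x₀)
  have h0 : ContinuousAt φ F := hφ.1.self_of_nhds.1.continuousAt
  have h1 : ContinuousAt (fderiv ℝ φ) F := hφ.1.self_of_nhds.2.continuousAt
  obtain ⟨K, U, hU, hK⟩ := hφ.2
  have h2 : ContinuousAt (fderiv ℝ (fderiv ℝ φ)) F := hK.continuousOn.continuousAt hU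
  refine ⟨fun G => (|φ G - φ F| + ‖fderiv ℝ φ G - fderiv ℝ φ F‖ * (c + ‖F‖)
      + ‖fderiv ℝ φ G‖ * ‖G - F‖)
      + (‖fderiv ℝ (fderiv ℝ φ) G - fderiv ℝ (fderiv ℝ φ) F‖ * (c + ‖G‖) * (c + ‖G‖)
        + ‖fderiv ℝ (fderiv ℝ φ) F‖ * ‖G - F‖ * (c + ‖G‖)
        + ‖fderiv ℝ (fderiv ℝ φ) F‖ * (c + ‖F‖) * ‖G - F‖), ?_, ?_, ?_⟩
  · have t0 : Tendsto (fun G => |φ G - φ F|) (𝓝 F) (𝓝 0) :=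
      tendsto_iff_norm_sub_tendsto_zero.1 h0
    have t1 := tendsto_iff_norm_sub_tendsto_zero.1 h1.tendsto
    have t2 : Tendsto (fun G => ‖fderiv ℝ (fderiv ℝ φ) G - fderiv ℝ (fderiv ℝ φ) F‖) (𝓝 F) (𝓝 0) :=
      (tendsto_iff_norm_sub_tendsto_zero (E := D →L[ℝ] D →L[ℝ] ℝ)).1 h2
    have t3 := tendsto_iff_norm_sub_tendsto_zero.1 (tendsto_id (α := D) (x := 𝓝 F))
    have t4 : Tendsto (fun G : D => c + ‖G‖) (𝓝 F) (𝓝 (c + ‖F‖)) := tendsto_id.norm.const_add c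
    simpa using ((t0.add (t1.mul_const (c + ‖F‖))).add (h1.tendsto.norm.mul t3)).add
      ((((t2.mul t4).mul t4).add
        ((t3.const_mul ‖fderiv ℝ (fderiv ℝ φ) F‖).mul t4)).add
          (t3.const_mul (‖fderiv ℝ (fderiv ℝ φ) F‖ * (c + ‖F‖))))
  · exact fun G x => (abs_add_infl₁_sub_le hδ G x).trans (le_add_of_nonneg_right (by positivity))
  · exact fun G x y => (abs_infl₂_sub_le hδ G x y).trans (le_add_of_nonneg_left (by positivity))

end Functional

/-! ### Elementary inequalities for averages. -/

section Averages

theorem avg_add {E : Type*} [AddCommGroup E] [Module ℝ E] (n : ℕ) (f g : ℕ → E) :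
    avg n (fun k => f k + g k) = avg n f + avg n g := by
  simp [avg, Finset.sum_add_distrib]

theorem avg_sub {E : Type*} [AddCommGroup E] [Module ℝ E] (n : ℕ) (f g : ℕ → E) :
    avg n (fun k => f k - g k) = avg n f - avg n g := by
  simp [avg, Finset.sum_sub_distrib, smul_sub]

theorem avg_const_mul (n : ℕ) (c : ℝ) (f : ℕ → ℝ) : avg n (fun k => c * f k) = c * avg n f := by
  simp only [avg, smul_eq_mul, ← Finset.mul_sum]
  ring

theorem avg_mono {n : ℕ} {f g : ℕ → ℝ} (h : ∀ k, f k ≤ g k) : avg n f ≤ avg n g :=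
  smul_le_smul_of_nonneg_left (Finset.sum_le_sum fun k _ => h k) (by positivity)

theorem avg_nonneg {n : ℕ} {f : ℕ → ℝ} (h : ∀ k, 0 ≤ f k) : 0 ≤ avg n f :=
  smul_nonneg (by positivity) (Finset.sum_nonneg fun k _ => h k)

theorem avg_const_le {n : ℕ} {c : ℝ} (hc : 0 ≤ c) : avg n (fun _ => c) ≤ c := by
  rcases Nat.eq_zero_or_pos n with rfl | hn
  · simpa [avg] using hc
  · have : (n : ℝ) ≠ 0 := by positivity
    simp [avg, this]

theorem norm_avg_le {E : Type*} [NormedAddCommGroup E] [NormedSpace ℝ E] (n : ℕ) (f : ℕ → E) :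
    ‖avg n f‖ ≤ avg n fun k => ‖f k‖ := by
  rw [avg, norm_smul, Real.norm_of_nonneg (by positivity)]
  exact mul_le_mul_of_nonneg_left (norm_sum_le _ _) (by positivity)

theorem avg_mul_le_sqrt (n : ℕ) (f g : ℕ → ℝ) :
    avg n (fun k => f k * g k) ≤ √(avg n fun k => f k ^ 2) * √(avg n fun k => g k ^ 2) := by
  have h := Real.sum_mul_le_sqrt_mul_sqrt (Finset.range n) f g
  have hn : (0 : ℝ) ≤ (n : ℝ)⁻¹ := by positivity
  simp only [avg, smul_eq_mul]
  rw [Real.sqrt_mul hn, Real.sqrt_mul hn]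
  calc (n : ℝ)⁻¹ * ∑ k ∈ Finset.range n, f k * g k
      ≤ (n : ℝ)⁻¹ * (√(∑ k ∈ Finset.range n, f k ^ 2) * √(∑ k ∈ Finset.range n, g k ^ 2)) := by
        gcongr
    _ = (√(n : ℝ)⁻¹ * √(n : ℝ)⁻¹)
        * (√(∑ k ∈ Finset.range n, f k ^ 2) * √(∑ k ∈ Finset.range n, g k ^ 2)) := by
        rw [Real.mul_self_sqrt hn]
    _ = _ := by ring

theorem sq_avg_le (n : ℕ) (f : ℕ → ℝ) : avg n f ^ 2 ≤ avg n fun k => f k ^ 2 := by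
  have h := sq_sum_le_card_mul_sum_sq (s := Finset.range n) (f := f)
  rw [Finset.card_range] at h
  rcases Nat.eq_zero_or_pos n with rfl | hn
  · simp [avg]
  · simp only [avg, smul_eq_mul]
    rw [mul_pow]
    have hn' : (0 : ℝ) < n := by positivity
    calc ((n : ℝ)⁻¹) ^ 2 * (∑ k ∈ Finset.range n, f k) ^ 2
        ≤ ((n : ℝ)⁻¹) ^ 2 * (n * ∑ k ∈ Finset.range n, f k ^ 2) := by gcongr
      _ = _ := by field_simp

/-- The factor `6` is Cauchy–Schwarz for six summands. The factors `2` arise because the squared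
averages of `x` and `y` are absorbed into the averages of their squares. -/
theorem avg_sq_le_of_le {n : ℕ} {C ρ : ℝ} {d x y z w : ℕ → ℝ} (hd : ∀ k, 0 ≤ d k)
    (h : ∀ k, d k ≤ C * x k + ρ * y k + z k + (C * avg n x + ρ * avg n y) + w k) :
    avg n (fun k => d k ^ 2) ≤ 6 * (2 * C ^ 2 * (avg n fun k => x k ^ 2)
      + 2 * ρ ^ 2 * (avg n fun k => y k ^ 2) + (avg n fun k => z k ^ 2)
      + avg n fun k => w k ^ 2) := by
  have h1 : ∀ k, d k ^ 2 ≤ 6 * C ^ 2 * x k ^ 2 + 6 * ρ ^ 2 * y k ^ 2 + 6 * z k ^ 2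
      + 6 * w k ^ 2 + 6 * (C ^ 2 * avg n x ^ 2 + ρ ^ 2 * avg n y ^ 2) := by
    intro k
    have hs := sq_sum_le_card_mul_sum_sq (s := Finset.univ)
      (f := ![C * x k, ρ * y k, z k, C * avg n x, ρ * avg n y, w k])
    simp only [Fin.sum_univ_six, Finset.card_univ, Fintype.card_fin] at hs
    have h2 : d k ^ 2 ≤ (C * x k + ρ * y k + z k + (C * avg n x + ρ * avg n y) + w k) ^ 2 :=
      pow_le_pow_left₀ (hd k) (h k) 2
    refine h2.trans (le_trans (le_of_eq ?_) (hs.trans (le_of_eq ?_)))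
    · simp
      ring
    · simp
      ring
  have h2 := avg_mono (n := n) h1
  simp only [avg_add, avg_const_mul] at h2
  have h3 : avg n (fun _ => C ^ 2 * avg n x ^ 2) ≤ C ^ 2 * avg n fun k => x k ^ 2 :=
    (avg_const_le (by positivity)).trans
      (mul_le_mul_of_nonneg_left (sq_avg_le n x) (by positivity))
  have h4 : avg n (fun _ => ρ ^ 2 * avg n y ^ 2) ≤ ρ ^ 2 * avg n fun k => y k ^ 2 :=
    (avg_const_le (by positivity)).trans
      (mul_le_mul_of_nonneg_left (sq_avg_le n y) (by positivity))
  rw [avg_const_mul] at h3 h4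
  linarith

/-- Expand `a = b + (a - b)` in the product and apply Cauchy–Schwarz to the cross terms. -/
theorem abs_avg_mul_sub_avg_mul_le {ι : Type*} [Fintype ι] (n : ℕ) (a b : ℕ → EuclideanSpace ℝ ι)
    (i j : ι) :
    |avg n (fun k => a k i * a k j) - avg n fun k => b k i * b k j| ≤
      avg n (fun k => ‖a k - b k‖ ^ 2)
        + 2 * (√(avg n fun k => ‖a k - b k‖ ^ 2) * √(avg n fun k => ‖b k‖ ^ 2)) := by
  rw [← avg_sub]
  refine (norm_avg_le n fun k => a k i * a k j - b k i * b k j).trans ?_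
  have h1 : ∀ k, ‖a k i * a k j - b k i * b k j‖
      ≤ ‖a k - b k‖ ^ 2 + 2 * (‖a k - b k‖ * ‖b k‖) := by
    intro k
    have hi := PiLp.norm_apply_le (a k - b k) i
    have hj := PiLp.norm_apply_le (a k - b k) j
    have hbi := PiLp.norm_apply_le (b k) i
    have hbj := PiLp.norm_apply_le (b k) j
    simp only [PiLp.sub_apply] at hi hj
    have heq : a k i * a k j - b k i * b k j = (a k i - b k i) * (a k j - b k j)
        + (a k i - b k i) * b k j + b k i * (a k j - b k j) := by ring
    rw [heq]
    refine (norm_add₃_le).trans ?_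
    rw [norm_mul, norm_mul, norm_mul]
    have e1 := mul_le_mul hi hj (norm_nonneg _) (norm_nonneg _)
    have e2 := mul_le_mul hi hbj (norm_nonneg _) (norm_nonneg _)
    have e3 := mul_le_mul hbi hj (norm_nonneg _) (norm_nonneg _)
    linarith
  refine (avg_mono h1).trans ?_
  rw [avg_add, avg_const_mul]
  have := avg_mul_le_sqrt n (fun k => ‖a k - b k‖) fun k => ‖b k‖
  linarith

end Averages

/-- Needed for uniqueness of limits along the filter. -/
instance {Ω : Type*} [MeasurableSpace Ω] (P : Measure Ω) [IsProbabilityMeasure P] :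
    (inProb P).NeBot := by
  refine ⟨fun h => ?_⟩
  have h0 : ∀ᶠ _ in inProb P, False := by rw [h]; exact eventually_bot
  rw [eventually_inProb] at h0
  simp at h0

theorem DominatedSqIntegrableNear.memLp {B 𝒵 E : Type*} [TopologicalSpace B] [MeasurableSpace 𝒵]
    [NormedAddCommGroup E] {f : B → 𝒵 → E} {ν : Measure 𝒵} {β₀ : B}
    (h : DominatedSqIntegrableNear f ν β₀) (hm : AEStronglyMeasurable (f β₀) ν) :
    MemLp (f β₀) 2 ν := by
  obtain ⟨N, hN, H, hH, hle⟩ := h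
  exact hH.mono hm (hle.mono fun z hz => (hz β₀ (mem_of_mem_nhds hN)).trans (le_abs_self _))

/-! ### Conditioning on one of two independent variables. -/

section CondExp

variable {Ω 𝒲 𝒴 E : Type*} [MeasurableSpace Ω] [m𝒲 : MeasurableSpace 𝒲] [MeasurableSpace 𝒴]
  [NormedAddCommGroup E] [NormedSpace ℝ E] [CompleteSpace E]
  {P : Measure Ω} [IsProbabilityMeasure P] {W : Ω → 𝒲} {Y : Ω → 𝒴}

/-- Under independence the joint law is a product, so integrating out `Y` with `W` frozen has the
right integral over every event `W ⁻¹' t`. -/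
theorem condExp_prodMk_ae_eq_of_indepFun (hW : Measurable W) (hY : Measurable Y)
    (h : IndepFun W Y P) {g : 𝒲 × 𝒴 → E} (hg : StronglyMeasurable g)
    (hi : Integrable (fun ω => g (W ω, Y ω)) P) :
    P[fun ω => g (W ω, Y ω) | m𝒲.comap W] =ᵐ[P] fun ω => ∫ y, g (W ω, y) ∂(P.map Y) := by
  have := Measure.isProbabilityMeasure_map (μ := P) hW.aemeasurable
  have := Measure.isProbabilityMeasure_map (μ := P) hY.aemeasurable
  have hlaw := (indepFun_iff_map_prod_eq_prod_map_map hW.aemeasurable hY.aemeasurable).1 h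
  have hgi : Integrable g ((P.map W).prod (P.map Y)) := by
    rw [← hlaw]
    exact (integrable_map_measure hg.aestronglyMeasurable (hW.prodMk hY).aemeasurable).2 hi
  have hsm : StronglyMeasurable fun w => ∫ y, g (w, y) ∂(P.map Y) := hg.integral_prod_right'
  have hint : Integrable (fun ω => ∫ y, g (W ω, y) ∂(P.map Y)) P :=
    hgi.integral_prod_left.comp_measurable hW
  refine (ae_eq_condExp_of_forall_setIntegral_eq hW.comap_le hi
    (fun s _ _ => hint.integrableOn) ?_ ?_).symm
  · rintro _ ⟨t, ht, rfl⟩ _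
    calc ∫ ω in W ⁻¹' t, ∫ y, g (W ω, y) ∂(P.map Y) ∂P
        = ∫ w in t, ∫ y, g (w, y) ∂(P.map Y) ∂(P.map W) :=
          (setIntegral_map ht hsm.aestronglyMeasurable hW.aemeasurable).symm
      _ = ∫ p in t ×ˢ Set.univ, g p ∂((P.map W).prod (P.map Y)) := by
          rw [setIntegral_prod _ hgi.integrableOn]
          simp
      _ = ∫ ω in W ⁻¹' t, g (W ω, Y ω) ∂P := by
          rw [← hlaw, setIntegral_map (ht.prod MeasurableSet.univ) hg.aestronglyMeasurable
            (hW.prodMk hY).aemeasurable]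
          congr 2
          ext ω
          simp
  · exact (hsm.comp_measurable (comap_measurable W)).aestronglyMeasurable

end CondExp

/-! ### The second-order correction and its projection. -/

section Projection

variable {𝒳 𝒵 E : Type*} [NormedAddCommGroup E] [InnerProductSpace ℝ E]
  {κ : 𝒳 × 𝒳 → ℝ} {a : 𝒵 → E} {C : ℝ}

theorem norm_kernel_smul_le (hC : ∀ p, |κ p| ≤ C) (x : 𝒳) (y : 𝒳 × 𝒵) :
    ‖κ (y.1, x) • a y.2‖ ≤ C * ‖a y.2‖ := by
  rw [norm_smul]
  exact mul_le_mul_of_nonneg_right (hC _) (norm_nonneg _)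

variable [MeasurableSpace 𝒳] [MeasurableSpace 𝒵] {ν : Measure (𝒳 × 𝒵)}

/-- The projection `x ↦ E(κ(X, x) a(Z))`, where `(X, Z)` has law `ν`. -/
noncomputable def kernelProj (κ : 𝒳 × 𝒳 → ℝ) (a : 𝒵 → E) (ν : Measure (𝒳 × 𝒵)) (x : 𝒳) : E :=
  ∫ y, κ (y.1, x) • a y.2 ∂ν

theorem stronglyMeasurable_kernel_smul (hκ : Measurable κ) (ha : StronglyMeasurable a) :
    StronglyMeasurable fun p : 𝒳 × (𝒳 × 𝒵) => κ (p.2.1, p.1) • a p.2.2 :=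
  (hκ.comp ((measurable_fst.comp measurable_snd).prodMk measurable_fst)).stronglyMeasurable.smul
    (ha.comp_measurable (measurable_snd.comp measurable_snd))

theorem stronglyMeasurable_kernelProj [SFinite ν] (hκ : Measurable κ) (ha : StronglyMeasurable a) :
    StronglyMeasurable (kernelProj κ a ν) :=
  (stronglyMeasurable_kernel_smul hκ ha).integral_prod_right'

theorem integrable_kernel_smul (hκ : Measurable κ) (ha : StronglyMeasurable a)
    (hC : ∀ p, |κ p| ≤ C) (hai : Integrable (fun y => a y.2) ν) (x : 𝒳) :
    Integrable (fun y => κ (y.1, x) • a y.2) ν :=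
  (hai.norm.const_mul C).mono'
    ((stronglyMeasurable_kernel_smul hκ ha).comp_measurable
      measurable_prodMk_left).aestronglyMeasurable
    (ae_of_all _ (norm_kernel_smul_le hC x))

theorem norm_kernelProj_le (hC : ∀ p, |κ p| ≤ C)
    (hai : Integrable (fun y => a y.2) ν) (x : 𝒳) :
    ‖kernelProj κ a ν x‖ ≤ ∫ y, C * ‖a y.2‖ ∂ν :=
  norm_integral_le_of_norm_le (hai.norm.const_mul C) (ae_of_all _ (norm_kernel_smul_le hC x))

variable {Ω : Type*} [MeasurableSpace Ω] {P : Measure Ω} {X : ℕ → Ω → 𝒳} {Z : ℕ → Ω → 𝒵}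

theorem integrable_kernel_smul_comp
    (hXm : ∀ k, Measurable (X k)) (hZm : ∀ k, Measurable (Z k))
    (hident : ∀ k, IdentDistrib (fun ω => (X k ω, Z k ω)) (fun ω => (X 0 ω, Z 0 ω)) P P)
    (hκ : Measurable κ) (ha : StronglyMeasurable a) (hC : ∀ p, |κ p| ≤ C)
    (hai : Integrable (fun y : 𝒳 × 𝒵 => a y.2) (P.map fun ω => (X 0 ω, Z 0 ω))) :
    Integrable (fun ω => κ (X 1 ω, X 0 ω) • a (Z 1 ω)) P := by
  rw [← (hident 1).map_eq] at hai
  refine ((hai.comp_measurable ((hXm 1).prodMk (hZm 1))).norm.const_mul C).mono' ?_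
    (ae_of_all _ fun ω => norm_kernel_smul_le hC (X 0 ω) (X 1 ω, Z 1 ω))
  exact ((stronglyMeasurable_kernel_smul hκ ha).comp_measurable
    ((hXm 0).prodMk ((hXm 1).prodMk (hZm 1)))).aestronglyMeasurable

variable [IsProbabilityMeasure P] [CompleteSpace E]

/-- Subtracting the projection centres the kernel in its first argument. Boundedness of `κ` gives a
majorant depending on that argument alone, so the degenerate case applies. -/
theorem tendsto_avg_norm_sub_kernelProj_sq
    (hXm : ∀ k, Measurable (X k)) (hZm : ∀ k, Measurable (Z k))
    (hindep : iIndepFun (fun k ω => (X k ω, Z k ω)) P)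
    (hident : ∀ k, IdentDistrib (fun ω => (X k ω, Z k ω)) (fun ω => (X 0 ω, Z 0 ω)) P P)
    (hκ : Measurable κ) (ha : StronglyMeasurable a) (hC : ∀ p, |κ p| ≤ C)
    (ha2 : MemLp (fun y : 𝒳 × 𝒵 => a y.2) 2 (P.map fun ω => (X 0 ω, Z 0 ω))) :
    Tendsto (fun t : ℕ × Ω => avg t.1 fun k =>
      ‖(avg t.1 fun j => κ (X j t.2, X k t.2) • a (Z j t.2))
        - kernelProj κ a (P.map fun ω => (X 0 ω, Z 0 ω)) (X k t.2)‖ ^ 2) (inProb P) (𝓝 0) := by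
  set ν := P.map fun ω => (X 0 ω, Z 0 ω) with hν
  have : IsProbabilityMeasure ν :=
    Measure.isProbabilityMeasure_map ((hXm 0).prodMk (hZm 0)).aemeasurable
  have hai := ha2.integrable one_le_two
  set M := ∫ y, C * ‖a y.2‖ ∂ν with hM
  set G : (𝒳 × 𝒵) × (𝒳 × 𝒵) → E :=
    fun p => κ (p.1.1, p.2.1) • a p.1.2 - kernelProj κ a ν p.2.1 with hG
  have hGm : StronglyMeasurable G :=
    ((stronglyMeasurable_kernel_smul hκ ha).comp_measurable
      ((measurable_fst.comp measurable_snd).prodMk measurable_fst)).sub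
      ((stronglyMeasurable_kernelProj hκ ha).comp_measurable (measurable_fst.comp measurable_snd))
  have hb : MemLp (fun y : 𝒳 × 𝒵 => C * ‖a y.2‖ + M) 2 ν :=
    (ha2.norm.const_mul C).add (memLp_const M)
  have key := tendsto_avg_norm_avg_sq (Y := fun k ω => (X k ω, Z k ω))
    (fun k => (hXm k).prodMk (hZm k)) hindep hident hGm hb
    (fun y y' => (norm_sub_le _ _).trans
      (add_le_add (norm_kernel_smul_le hC y.1 y') (norm_kernelProj_le hC hai y.1)))
    (fun y => by
      simp only [hG]
      rw [integral_sub (integrable_kernel_smul hκ ha hC hai y.1) (integrable_const _)]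
      simp [kernelProj])
  refine key.congr' ?_
  -- For `n = 0` the average of a constant is zero, so the projection can be moved inside the
  -- average only for `n ≥ 1`.
  filter_upwards [tendsto_fst_inProb.eventually (eventually_ge_atTop 1)] with t ht
  have h1 : (t.1 : ℝ) ≠ 0 := by
    have : t.1 ≠ 0 := by omega
    exact_mod_cast this
  simp only [hG, avg_sub]
  have : ∀ v : E, avg t.1 (fun _ => v) = v := fun v => by
    rw [avg, Finset.sum_const, Finset.card_range, ← Nat.cast_smul_eq_nsmul ℝ, smul_smul,
      inv_mul_cancel₀ h1, one_smul]
  simp only [this]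

theorem condExp_kernel_smul_ae_eq
    (hXm : ∀ k, Measurable (X k)) (hZm : ∀ k, Measurable (Z k))
    (hindep : iIndepFun (fun k ω => (X k ω, Z k ω)) P)
    (hident : ∀ k, IdentDistrib (fun ω => (X k ω, Z k ω)) (fun ω => (X 0 ω, Z 0 ω)) P P)
    (hκ : Measurable κ) (ha : StronglyMeasurable a) (hC : ∀ p, |κ p| ≤ C)
    (hai : Integrable (fun y : 𝒳 × 𝒵 => a y.2) (P.map fun ω => (X 0 ω, Z 0 ω))) :
    P[fun ω => κ (X 1 ω, X 0 ω) • a (Z 1 ω) | MeasurableSpace.comap (X 0) inferInstance] =ᵐ[P]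
      fun ω => kernelProj κ a (P.map fun ω => (X 0 ω, Z 0 ω)) (X 0 ω) := by
  have h := condExp_prodMk_ae_eq_of_indepFun (P := P) (W := X 0) (Y := fun ω => (X 1 ω, Z 1 ω))
    (g := fun p => κ (p.2.1, p.1) • a p.2.2) (hXm 0) ((hXm 1).prodMk (hZm 1))
    ((hindep.indepFun zero_ne_one).comp measurable_fst measurable_id)
    (stronglyMeasurable_kernel_smul hκ ha)
    (integrable_kernel_smul_comp hXm hZm hident hκ ha hC hai)
  rw [(hident 1).map_eq] at h
  exact h

/-- The integral is that of `κ(X 1, X 0) a(Z 1)`; integrating over `X 0` first, with `(X 1, Z 1)`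
frozen, gives zero. -/
theorem integral_kernelProj_apply_eq_zero {q : ℕ} {a : 𝒵 → EuclideanSpace ℝ (Fin q)}
    (hXm : ∀ k, Measurable (X k)) (hZm : ∀ k, Measurable (Z k))
    (hindep : iIndepFun (fun k ω => (X k ω, Z k ω)) P)
    (hident : ∀ k, IdentDistrib (fun ω => (X k ω, Z k ω)) (fun ω => (X 0 ω, Z 0 ω)) P P)
    (hκ : Measurable κ) (ha : StronglyMeasurable a) (hC : ∀ p, |κ p| ≤ C)
    (hai : Integrable (fun y : 𝒳 × 𝒵 => a y.2) (P.map fun ω => (X 0 ω, Z 0 ω)))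
    (hκ0 : ∀ x, ∫ ω, κ (x, X 0 ω) ∂P = 0) (i : Fin q) :
    ∫ ω, kernelProj κ a (P.map fun ω => (X 0 ω, Z 0 ω)) (X 0 ω) i ∂P = 0 := by
  have hce := condExp_kernel_smul_ae_eq hXm hZm hindep hident hκ ha hC hai
  have hint := integrable_kernel_smul_comp hXm hZm hident hκ ha hC hai
  have hproj := integrable_condExp.congr hce
  have e1 : ∫ ω, kernelProj κ a (P.map fun ω => (X 0 ω, Z 0 ω)) (X 0 ω) i ∂P
      = (∫ ω, kernelProj κ a (P.map fun ω => (X 0 ω, Z 0 ω)) (X 0 ω) ∂P) i :=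
    (EuclideanSpace.proj (𝕜 := ℝ) i).integral_comp_comm hproj
  have e2 : ∫ ω, κ (X 1 ω, X 0 ω) * a (Z 1 ω) i ∂P
      = (∫ ω, κ (X 1 ω, X 0 ω) • a (Z 1 ω) ∂P) i :=
    (EuclideanSpace.proj (𝕜 := ℝ) i).integral_comp_comm hint
  rw [e1, ← integral_congr_ae hce, integral_condExp (hXm 0).comap_le, ← e2]
  have hcoord : Measurable fun z => a z i :=
    ((EuclideanSpace.proj (𝕜 := ℝ) i).continuous.measurable).comp ha.measurable
  have hbd : ∀ x, Integrable (fun x' => κ (x, x')) (P.map (X 0)) := fun x => by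
    have := Measure.isProbabilityMeasure_map (μ := P) (hXm 0).aemeasurable
    exact Integrable.of_bound (hκ.comp measurable_prodMk_left).aestronglyMeasurable C
      (ae_of_all _ fun x' => hC _)
  have h := integral_inner_eq_zero_of_integral_eq_zero (P := P)
    (W := fun ω => (X 1 ω, Z 1 ω)) (Y := X 0) (u := fun w => a w.2 i)
    (g := fun p => κ (p.1.1, p.2)) ((hXm 1).prodMk (hZm 1)) (hXm 0)
    ((hindep.indepFun one_ne_zero).comp measurable_id measurable_fst)
    (hcoord.comp measurable_snd).stronglyMeasurable
    (hκ.comp ((measurable_fst.comp measurable_fst).prodMk measurable_snd)).stronglyMeasurable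
    (fun w => hbd w.1) (fun w => by
      have hm : Measurable fun x' => κ (w.1, x') := hκ.comp measurable_prodMk_left
      rw [integral_map (hXm 0).aemeasurable hm.aestronglyMeasurable]
      exact hκ0 w.1)
  simpa using h

end Projection

/-! ### Comparison of the estimated terms with the score. -/

section Terms

variable {Ω 𝒳 𝒵 D : Type*} [NormedAddCommGroup D] [NormedSpace ℝ D] {q : ℕ}

/-- The vector whose outer square is the `k`-th summand of `sigmaPV`, at the parameter value `β`. -/
noncomputable def pvTerm (φ : D → ℝ) (δ : 𝒳 → D)
    (A : EuclideanSpace ℝ (Fin q) → 𝒵 → EuclideanSpace ℝ (Fin q))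
    (μ : EuclideanSpace ℝ (Fin q) → 𝒵 → ℝ) (X : ℕ → Ω → 𝒳) (Z : ℕ → Ω → 𝒵)
    (β : EuclideanSpace ℝ (Fin q)) (n : ℕ) (ω : Ω) (k : ℕ) : EuclideanSpace ℝ (Fin q) :=
  (φ (sampleMean δ X n ω) + infl₁ φ δ (sampleMean δ X n ω) (X k ω) - μ β (Z k ω)) • A β (Z k ω)
    + hHat φ δ A X Z n ω β (X k ω)

/-- The score at the truth, as a function of the observation, with second-order correction `h`. -/
noncomputable def scoreFun (φ : D → ℝ) (δ : 𝒳 → D) (F : D)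
    (A : EuclideanSpace ℝ (Fin q) → 𝒵 → EuclideanSpace ℝ (Fin q))
    (μ : EuclideanSpace ℝ (Fin q) → 𝒵 → ℝ) (β₀ : EuclideanSpace ℝ (Fin q))
    (h : 𝒳 → EuclideanSpace ℝ (Fin q)) (y : 𝒳 × 𝒵) : EuclideanSpace ℝ (Fin q) :=
  (φ F + infl₁ φ δ F y.1 - μ β₀ y.2) • A β₀ y.2 + h y.1

variable {φ : D → ℝ} {δ : 𝒳 → D} {F : D}
  {A : EuclideanSpace ℝ (Fin q) → 𝒵 → EuclideanSpace ℝ (Fin q)}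
  {μ : EuclideanSpace ℝ (Fin q) → 𝒵 → ℝ} {X : ℕ → Ω → 𝒳} {Z : ℕ → Ω → 𝒵}

theorem sigmaPV_apply (βhat : ℕ → Ω → EuclideanSpace ℝ (Fin q)) (n : ℕ) (ω : Ω) (i j : Fin q) :
    sigmaPV φ δ A μ X Z βhat n ω i j = avg n fun k =>
      pvTerm φ δ A μ X Z (βhat n ω) n ω k i * pvTerm φ δ A μ X Z (βhat n ω) n ω k j := by
  simp only [sigmaPV, avg, pvTerm, Matrix.smul_apply, Matrix.sum_apply, Matrix.vecMulVec_apply]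

theorem norm_smul_sub_smul_le {E : Type*} [NormedAddCommGroup E] [NormedSpace ℝ E] {s t C ρ : ℝ}
    (u v : E) (ht : |t| ≤ C) (hst : |s - t| ≤ ρ) :
    ‖s • u - t • v‖ ≤ (C + ρ) * ‖u - v‖ + ρ * ‖v‖ := by
  have hs : |s| ≤ C + ρ := by
    have := abs_add_le t (s - t)
    rw [add_sub_cancel] at this
    linarith
  have heq : s • u - t • v = s • (u - v) + (s - t) • v := by
    rw [smul_sub, sub_smul]; abel
  rw [heq]
  refine (norm_add_le _ _).trans ?_
  rw [norm_smul, norm_smul, Real.norm_eq_abs, Real.norm_eq_abs]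
  gcongr

theorem norm_pvTerm_sub_scoreFun_le {C ρ : ℝ} {G : D} {n : ℕ} {ω : Ω}
    (hG : sampleMean δ X n ω = G)
    (h₁ : ∀ x, |φ F + infl₁ φ δ F x| ≤ C)
    (h₁' : ∀ x, |(φ G + infl₁ φ δ G x) - (φ F + infl₁ φ δ F x)| ≤ ρ)
    (h₂ : ∀ x y, |infl₂ φ δ F x y| ≤ C)
    (h₂' : ∀ x y, |infl₂ φ δ G x y - infl₂ φ δ F x y| ≤ ρ)
    (hsymm : ∀ x y, infl₂ φ δ F x y = infl₂ φ δ F y x)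
    (β β₀ : EuclideanSpace ℝ (Fin q)) (h : 𝒳 → EuclideanSpace ℝ (Fin q)) (k : ℕ) :
    ‖pvTerm φ δ A μ X Z β n ω k - scoreFun φ δ F A μ β₀ h (X k ω, Z k ω)‖ ≤
      (C + ρ) * ‖A β (Z k ω) - A β₀ (Z k ω)‖ + ρ * ‖A β₀ (Z k ω)‖
        + ‖μ β (Z k ω) • A β (Z k ω) - μ β₀ (Z k ω) • A β₀ (Z k ω)‖
        + ((C + ρ) * avg n (fun j => ‖A β (Z j ω) - A β₀ (Z j ω)‖)
          + ρ * avg n fun j => ‖A β₀ (Z j ω)‖)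
        + ‖avg n (fun j => infl₂ φ δ F (X j ω) (X k ω) • A β₀ (Z j ω)) - h (X k ω)‖ := by
  have heq : pvTerm φ δ A μ X Z β n ω k - scoreFun φ δ F A μ β₀ h (X k ω, Z k ω)
      = ((φ G + infl₁ φ δ G (X k ω)) • A β (Z k ω) - (φ F + infl₁ φ δ F (X k ω)) • A β₀ (Z k ω))
        - (μ β (Z k ω) • A β (Z k ω) - μ β₀ (Z k ω) • A β₀ (Z k ω))
        + avg n (fun j => infl₂ φ δ G (X k ω) (X j ω) • A β (Z j ω)
            - infl₂ φ δ F (X k ω) (X j ω) • A β₀ (Z j ω))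
        + (avg n (fun j => infl₂ φ δ F (X j ω) (X k ω) • A β₀ (Z j ω)) - h (X k ω)) := by
    -- Symmetry of the second derivative reconciles the argument order of `hHat` with that of the
    -- projection.
    simp only [pvTerm, scoreFun, hHat, hG, avg_sub, hsymm (X k ω), sub_smul]
    simp only [avg]
    abel
  rw [heq]
  refine (norm_add_le _ _).trans (add_le_add ((norm_add_le _ _).trans
    (add_le_add ((norm_sub_le _ _).trans (add_le_add ?_ le_rfl)) ?_)) le_rfl)
  · exact norm_smul_sub_smul_le _ _ (h₁ _) (h₁' _)
  · refine (norm_avg_le _ _).trans ((avg_mono fun j =>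
      norm_smul_sub_smul_le _ _ (h₂ _ _) (h₂' _ _)).trans_eq ?_)
    rw [avg_add, avg_const_mul, avg_const_mul]

end Terms

/-! ### Consistency of the sample averages, centring and square integrability of the score. -/

section Consistency

variable {Ω 𝒳 𝒵 D : Type*} [MeasurableSpace Ω]
  [NormedAddCommGroup D] [NormedSpace ℝ D] {P : Measure Ω} {φ : D → ℝ} {δ : 𝒳 → D} {F : D}
  {X : ℕ → Ω → 𝒳}

theorem tendsto_sampleMean
    (hF : TendstoInMeasure P (fun (n : ℕ) ω => (n : ℝ) ^ (1 / 4 : ℝ) * ‖F - sampleMean δ X n ω‖)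
      atTop (fun _ => 0)) :
    Tendsto (fun t : ℕ × Ω => sampleMean δ X t.1 t.2) (inProb P) (𝓝 F) := by
  rw [tendstoInMeasure_const_iff] at hF
  rw [tendsto_iff_norm_sub_tendsto_zero]
  refine squeeze_zero' (Eventually.of_forall fun _ => norm_nonneg _) ?_ hF
  filter_upwards [tendsto_fst_inProb.eventually (eventually_ge_atTop 1)] with t ht
  rw [norm_sub_rev]
  exact le_mul_of_one_le_left (norm_nonneg _)
    (Real.one_le_rpow (by exact_mod_cast ht) (by norm_num))

variable [MeasurableSpace 𝒳] [MeasurableSpace 𝒵] [IsProbabilityMeasure P]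

/-- The averages of `L (δ (X k) - F)` equal `L (F_n - F)`, which tends to zero, while the law of
large numbers sends them to the expectation. No integral in `D` and no measurability of `δ` itself
is involved. -/
theorem integral_clm_comp_sub_eq_zero (hXm : ∀ k, Measurable (X k)) (hindep : iIndepFun X P)
    (hident : ∀ k, IdentDistrib (X k) (X 0) P P)
    (hF : Tendsto (fun t : ℕ × Ω => sampleMean δ X t.1 t.2) (inProb P) (𝓝 F))
    {c : ℝ} (hδ : ∀ x, ‖δ x‖ ≤ c) (L : D →L[ℝ] ℝ) (hL : Measurable fun x => L (δ x - F)) :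
    ∫ ω, L (δ (X 0 ω) - F) ∂P = 0 := by
  have hint : Integrable (fun ω => L (δ (X 0 ω) - F)) P :=
    Integrable.of_bound (hL.comp (hXm 0)).aestronglyMeasurable (‖L‖ * (c + ‖F‖))
      (ae_of_all _ fun ω => (L.le_opNorm _).trans
        (by gcongr; exact (norm_sub_le _ _).trans (by gcongr; exact hδ _)))
  have h1 := tendsto_avg_integral hindep hident hL hint
  have h2 : Tendsto (fun t : ℕ × Ω => L (sampleMean δ X t.1 t.2 - F)) (inProb P) (𝓝 0) := by
    have := (L.continuous.tendsto (F - F)).comp (hF.sub_const F)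
    rw [sub_self, map_zero] at this
    exact this
  refine tendsto_nhds_unique h1 (h2.congr' ?_)
  filter_upwards [tendsto_fst_inProb.eventually (eventually_ge_atTop 1)] with t ht
  have h0 : (t.1 : ℝ) ≠ 0 := by
    have : t.1 ≠ 0 := by omega
    exact_mod_cast this
  simp [sampleMean, avg, map_sub, map_sum, Finset.sum_sub_distrib, mul_sub, h0]

variable {q : ℕ} {Z : ℕ → Ω → 𝒵}
  {A : EuclideanSpace ℝ (Fin q) → 𝒵 → EuclideanSpace ℝ (Fin q)}
  {μ : EuclideanSpace ℝ (Fin q) → 𝒵 → ℝ} {β₀ : EuclideanSpace ℝ (Fin q)}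

/-- The first-order part of the score is centred. -/
theorem integral_smul_apply_eq_zero {V : Ω → ℝ} {X : Ω → 𝒳} {Z : Ω → 𝒵}
    (hZm : Measurable Z) (hXm : Measurable X)
    (hmean : P[V | MeasurableSpace.comap Z inferInstance] =ᵐ[P] fun ω => μ β₀ (Z ω))
    (hcenter : P[fun ω => infl₁ φ δ F (X ω) | MeasurableSpace.comap Z inferInstance] =ᵐ[P]
      fun ω => (P[V | MeasurableSpace.comap Z inferInstance]) ω - φ F)
    (hm₁ : Measurable (infl₁ φ δ F)) {C : ℝ} (hC : ∀ x, |infl₁ φ δ F x| ≤ C)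
    (hA : Measurable (A β₀)) (hAi : Integrable (fun ω => A β₀ (Z ω)) P)
    (hAμi : Integrable (fun ω => μ β₀ (Z ω) • A β₀ (Z ω)) P) (i : Fin q) :
    ∫ ω, ((φ F + infl₁ φ δ F (X ω) - μ β₀ (Z ω)) • A β₀ (Z ω)) i ∂P = 0 := by
  set m : MeasurableSpace Ω := MeasurableSpace.comap Z inferInstance with hm
  have hle : m ≤ _ := hZm.comap_le
  -- The integrand is `f * g` with `f` measurable for `σ(Z)` and `g` of conditional mean zero given
  -- `Z`.
  set g : Ω → ℝ := fun ω => infl₁ φ δ F (X ω) - (μ β₀ (Z ω) - φ F) with hg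
  set f : Ω → ℝ := fun ω => A β₀ (Z ω) i with hf
  have hii : Integrable (fun ω => infl₁ φ δ F (X ω)) P :=
    Integrable.of_bound (hm₁.comp hXm).aestronglyMeasurable C (ae_of_all _ fun ω => hC _)
  have hμi : Integrable (fun ω => μ β₀ (Z ω)) P := integrable_condExp.congr hmean
  have hr : Integrable (fun ω => μ β₀ (Z ω) - φ F) P := hμi.sub (integrable_const _)
  have hgi : Integrable g P := hii.sub hr
  have hfm : StronglyMeasurable[m] f := by
    have : Measurable fun z => A β₀ z i :=
      ((EuclideanSpace.proj (𝕜 := ℝ) i).continuous.measurable).comp hA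
    exact (this.comp (comap_measurable Z)).stronglyMeasurable
  have hfi : Integrable f P := (EuclideanSpace.proj (𝕜 := ℝ) i).integrable_comp hAi
  have hμf : Integrable (fun ω => μ β₀ (Z ω) * A β₀ (Z ω) i) P :=
    (EuclideanSpace.proj (𝕜 := ℝ) i).integrable_comp hAμi
  -- Here `μ` enters only through `μ • A`, which is integrable by assumption; the rest is a bounded
  -- factor times `f`.
  have hfg : Integrable (f * g) P := by
    have h1 : Integrable (fun ω => (φ F + infl₁ φ δ F (X ω)) * f ω) P :=
      hfi.bdd_mul (c := |φ F| + C) (hii.aestronglyMeasurable.const_add (φ F))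
        (ae_of_all _ fun ω => (abs_add_le _ _).trans (by gcongr; exact hC _))
    refine (h1.sub hμf).congr (ae_of_all _ fun ω => ?_)
    simp only [Pi.sub_apply, Pi.mul_apply, hf, hg]
    ring
  have hce : P[g | m] =ᵐ[P] 0 := by
    -- The conditional expectation of `V` serves as the `σ(Z)`-measurable version of `μ β₀ (Z ω)`.
    have hrm : P[fun ω => μ β₀ (Z ω) - φ F | m] =ᵐ[P] fun ω => μ β₀ (Z ω) - φ F := by
      have hae : (fun ω => μ β₀ (Z ω) - φ F) =ᵐ[P] fun ω => P[V | m] ω - φ F :=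
        hmean.symm.sub (ae_eq_refl _)
      have hs : StronglyMeasurable[m] fun ω => P[V | m] ω - φ F :=
        stronglyMeasurable_condExp.sub stronglyMeasurable_const
      refine (condExp_congr_ae hae).trans ?_
      rw [condExp_of_stronglyMeasurable hle hs (hr.congr hae)]
      exact hae.symm
    filter_upwards [condExp_sub hii hr m, hrm, hcenter, hmean] with ω e1 e2 e3 e4
    simp only [Pi.sub_apply] at e1
    have : P[g | m] ω = P[(fun ω => infl₁ φ δ F (X ω)) - fun ω => μ β₀ (Z ω) - φ F | m] ω := rfl
    rw [this, e1, e2, e3, e4]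
    simp
  have hfg0 : ∫ ω, (f * g) ω ∂P = 0 := by
    rw [← integral_condExp hle]
    refine integral_eq_zero_of_ae ?_
    filter_upwards [condExp_mul_of_stronglyMeasurable_left hfm hfg hgi, hce] with ω e1 e2
    rw [e1, Pi.mul_apply, e2]
    simp
  rw [← hfg0]
  refine integral_congr_ae (ae_of_all _ fun ω => ?_)
  simp only [PiLp.smul_apply, smul_eq_mul, Pi.mul_apply, hf, hg]
  ring

theorem memLp_scoreFun {ν : Measure (𝒳 × 𝒵)} [IsFiniteMeasure ν]
    (hm₁ : Measurable (infl₁ φ δ F)) {C M : ℝ} (hC : ∀ x, |infl₁ φ δ F x| ≤ C)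
    (hA2 : MemLp (fun y : 𝒳 × 𝒵 => A β₀ y.2) 2 ν)
    (hAμ2 : MemLp (fun y : 𝒳 × 𝒵 => μ β₀ y.2 • A β₀ y.2) 2 ν)
    {h : 𝒳 → EuclideanSpace ℝ (Fin q)} (hh : StronglyMeasurable h) (hM : ∀ x, ‖h x‖ ≤ M) :
    MemLp (scoreFun φ δ F A μ β₀ h) 2 ν := by
  have h1 : MemLp (fun y : 𝒳 × 𝒵 => (φ F + infl₁ φ δ F y.1) • A β₀ y.2) 2 ν := by
    refine (hA2.norm.const_mul (|φ F| + C)).mono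
      (((hm₁.comp measurable_fst).const_add (φ F)).aestronglyMeasurable.smul
        hA2.aestronglyMeasurable) (ae_of_all _ fun y => ?_)
    rw [norm_smul]
    refine le_trans ?_ (le_abs_self _)
    refine mul_le_mul_of_nonneg_right ?_ (norm_nonneg _)
    exact (abs_add_le _ _).trans (add_le_add le_rfl (hC _))
  have h2 : MemLp (fun y : 𝒳 × 𝒵 => h y.1) 2 ν :=
    MemLp.of_bound (hh.comp_measurable measurable_fst).aestronglyMeasurable M
      (ae_of_all _ fun y => hM y.1)
  refine ((h1.sub hAμ2).add h2).ae_eq (ae_of_all _ fun y => ?_)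
  simp [scoreFun, sub_smul]

end Consistency

/-! ### Assembling the limit. -/

section Main

variable {Ω 𝒳 𝒵 D : Type*} [MeasurableSpace Ω] [MeasurableSpace 𝒳] [MeasurableSpace 𝒵]
  [NormedAddCommGroup D] [NormedSpace ℝ D] {q : ℕ} {P : Measure Ω}
  {X : ℕ → Ω → 𝒳} {Z : ℕ → Ω → 𝒵}
  {Θ : Set (EuclideanSpace ℝ (Fin q))} {β₀ : EuclideanSpace ℝ (Fin q)}
  {μ : EuclideanSpace ℝ (Fin q) → 𝒵 → ℝ}
  {A : EuclideanSpace ℝ (Fin q) → 𝒵 → EuclideanSpace ℝ (Fin q)}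
  {φ : D → ℝ} {δ : 𝒳 → D} {F : D} {βhat : ℕ → Ω → EuclideanSpace ℝ (Fin q)}

/-- The correction `x ↦ E(A(β₀, Z) φ̈(X, x))` of the score. -/
noncomputable def scoreCorr (P : Measure Ω) (φ : D → ℝ) (δ : 𝒳 → D) (F : D)
    (A : EuclideanSpace ℝ (Fin q) → 𝒵 → EuclideanSpace ℝ (Fin q)) (β₀ : EuclideanSpace ℝ (Fin q))
    (X : ℕ → Ω → 𝒳) (Z : ℕ → Ω → 𝒵) : 𝒳 → EuclideanSpace ℝ (Fin q) :=
  kernelProj (fun p => infl₂ φ δ F p.1 p.2) (A β₀) (P.map fun ω => (X 0 ω, Z 0 ω))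

theorem tendsto_avg_norm_pvTerm_sub_sq [IsProbabilityMeasure P]
    (hXm : ∀ k, Measurable (X k)) (hZm : ∀ k, Measurable (Z k))
    (hindep : iIndepFun (fun k ω => (X k ω, Z k ω)) P)
    (hident : ∀ k, IdentDistrib (fun ω => (X k ω, Z k ω)) (fun ω => (X 0 ω, Z 0 ω)) P P)
    (hΘ : IsOpen Θ) (hβ₀ : β₀ ∈ Θ)
    (hμm : ∀ β ∈ Θ, Measurable (μ β)) (hAm : ∀ β ∈ Θ, Measurable (A β))
    (hF : Tendsto (fun t : ℕ × Ω => sampleMean δ X t.1 t.2) (inProb P) (𝓝 F))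
    {c : ℝ} (hδ : ∀ x, ‖δ x‖ ≤ c) (hφ : TwiceDiffLipschitzNear φ F)
    (hm₂ : Measurable (fun p : 𝒳 × 𝒳 => infl₂ φ δ F p.1 p.2))
    (hAc : ∀ z, ContinuousOn (fun β => A β z) Θ)
    (hμc : ∀ z, ContinuousOn (fun β => μ β z) Θ)
    (hAdom : DominatedSqIntegrableNear A (P.map (Z 0)) β₀)
    (hAμdom : DominatedSqIntegrableNear (fun β z => μ β z • A β z) (P.map (Z 0)) β₀)
    (hβhat : Tendsto (fun t : ℕ × Ω => βhat t.1 t.2) (inProb P) (𝓝 β₀)) :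
    Tendsto (fun t : ℕ × Ω => avg t.1 fun k =>
      ‖pvTerm φ δ A μ X Z (βhat t.1 t.2) t.1 t.2 k
        - scoreFun φ δ F A μ β₀ (scoreCorr P φ δ F A β₀ X Z) (X k t.2, Z k t.2)‖ ^ 2)
      (inProb P) (𝓝 0) := by
  obtain ⟨ρ, hρ, hρ₁, hρ₂⟩ := hφ.exists_modulus hδ
  set C := max (|φ F| + ‖fderiv ℝ φ F‖ * (c + ‖F‖))
    (‖fderiv ℝ (fderiv ℝ φ) F‖ * (c + ‖F‖) * (c + ‖F‖)) with hC
  have hC₁ : ∀ x, |φ F + infl₁ φ δ F x| ≤ C := fun x =>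
    ((abs_add_le _ _).trans (by gcongr; exact abs_infl₁_le hδ x)).trans (le_max_left _ _)
  have hC₂ : ∀ x y, |infl₂ φ δ F x y| ≤ C := fun x y =>
    (abs_infl₂_le hδ x y).trans (le_max_right _ _)
  have hlaw : ∀ k, P.map (Z k) = P.map (Z 0) := fun k =>
    ((hident k).comp measurable_snd).map_eq
  have hA2 : MemLp (A β₀) 2 (P.map (Z 0)) := hAdom.memLp (hAm β₀ hβ₀).aestronglyMeasurable
  have hA2Ω : MemLp (fun ω => A β₀ (Z 0 ω)) 2 P := hA2.comp_of_map (hZm 0).aemeasurable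
  have hA2ν : MemLp (fun y : 𝒳 × 𝒵 => A β₀ y.2) 2 (P.map fun ω => (X 0 ω, Z 0 ω)) :=
    (memLp_map_measure_iff ((hAm β₀ hβ₀).comp measurable_snd).aestronglyMeasurable
      ((hXm 0).prodMk (hZm 0)).aemeasurable).2 hA2Ω
  have hSA := tendsto_avg_norm_sub_sq hZm hlaw hΘ hβ₀ hAm hAc hAdom hβhat
  have hSM := tendsto_avg_norm_sub_sq hZm hlaw hΘ hβ₀ (f := fun β z => μ β z • A β z)
    (fun β hβ => (hμm β hβ).smul (hAm β hβ)) (fun z => (hμc z).smul (hAc z)) hAμdom hβhat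
  have hM := tendsto_avg_integral (P := P) hindep hident (u := fun y => ‖A β₀ y.2‖ ^ 2)
    (((hAm β₀ hβ₀).comp measurable_snd).norm.pow_const 2)
    (hA2Ω.integrable_norm_pow two_ne_zero)
  have hR := tendsto_avg_norm_sub_kernelProj_sq hXm hZm hindep hident hm₂
    (hAm β₀ hβ₀).stronglyMeasurable (fun p => hC₂ p.1 p.2) hA2ν
  have hρF := hρ.comp hF
  -- The upper bound tends to `6 * (2 * C ^ 2 * 0 + 2 * 0 ^ 2 * M + 0 + 0)`, where `M` is the second
  -- moment of `A β₀ (Z 0)`: the only average with a nonzero limit is multiplied by `ρ (F_n) ^ 2`.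
  have hup := (((((hρF.const_add C).pow 2).const_mul 2).mul hSA).add
    (((hρF.pow 2).const_mul 2).mul hM)).add hSM |>.add hR |>.const_mul 6
  refine squeeze_zero (fun t => avg_nonneg fun k => by positivity)
    (fun t => avg_sq_le_of_le (fun k => norm_nonneg _) fun k =>
      norm_pvTerm_sub_scoreFun_le rfl hC₁ (hρ₁ _) hC₂ (hρ₂ _) hφ.infl₂_comm (βhat t.1 t.2) β₀
        (scoreCorr P φ δ F A β₀ X Z) k) ?_
  simpa [scoreCorr] using hup

/-- Mean-square closeness to i.i.d. square integrable vectors is all that matters: the law of large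
numbers gives the limit of their products and bounds the second factor of the Cauchy–Schwarz term.
-/
theorem tendsto_sigmaPV_apply [IsProbabilityMeasure P]
    (hindep : iIndepFun (fun k ω => (X k ω, Z k ω)) P)
    (hident : ∀ k, IdentDistrib (fun ω => (X k ω, Z k ω)) (fun ω => (X 0 ω, Z 0 ω)) P P)
    {u : 𝒳 × 𝒵 → EuclideanSpace ℝ (Fin q)} (hum : Measurable u)
    (hu : MemLp (fun ω => u (X 0 ω, Z 0 ω)) 2 P)
    (h : Tendsto (fun t : ℕ × Ω => avg t.1 fun k =>
      ‖pvTerm φ δ A μ X Z (βhat t.1 t.2) t.1 t.2 k - u (X k t.2, Z k t.2)‖ ^ 2)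
      (inProb P) (𝓝 0)) (i j : Fin q) :
    Tendsto (fun t : ℕ × Ω => sigmaPV φ δ A μ X Z βhat t.1 t.2 i j) (inProb P)
      (𝓝 (∫ ω, u (X 0 ω, Z 0 ω) i * u (X 0 ω, Z 0 ω) j ∂P)) := by
  have hcoord : ∀ i, Measurable fun y => u y i := fun i =>
    ((EuclideanSpace.proj (𝕜 := ℝ) i).continuous.measurable).comp hum
  have hcoord2 : ∀ i, MemLp (fun ω => u (X 0 ω, Z 0 ω) i) 2 P := fun i =>
    (EuclideanSpace.proj (𝕜 := ℝ) i).comp_memLp' hu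
  have h1 := tendsto_avg_integral (P := P) hindep hident (u := fun y => u y i * u y j)
    ((hcoord i).mul (hcoord j)) ((hcoord2 i).integrable_mul (hcoord2 j))
  have h2 := tendsto_avg_integral (P := P) hindep hident (u := fun y => ‖u y‖ ^ 2)
    (hum.norm.pow_const 2) (hu.integrable_norm_pow two_ne_zero)
  have hup := h.add ((h.sqrt.mul h2.sqrt).const_mul 2)
  simp only [Real.sqrt_zero, zero_mul, mul_zero, add_zero] at hup
  have h3 := (tendsto_zero_iff_abs_tendsto_zero _).2 <| squeeze_zero (fun _ => abs_nonneg _)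
    (fun t : ℕ × Ω => abs_avg_mul_sub_avg_mul_le t.1
      (fun k => pvTerm φ δ A μ X Z (βhat t.1 t.2) t.1 t.2 k) (fun k => u (X k t.2, Z k t.2)) i j)
    hup
  have h4 := h3.add h1
  rw [zero_add] at h4
  refine h4.congr fun t => ?_
  rw [sub_add_cancel, sigmaPV_apply]

/-- Both parts of the score are centred, so no product of means is subtracted in the covariance; the
conditional expectation in `scoreVec` agrees almost surely with the projection. -/
theorem sigma_apply_eq_integral [IsProbabilityMeasure P] {V : Ω → ℝ}
    (hXm : ∀ k, Measurable (X k)) (hZm : ∀ k, Measurable (Z k))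
    (hindep : iIndepFun (fun k ω => (X k ω, Z k ω)) P)
    (hident : ∀ k, IdentDistrib (fun ω => (X k ω, Z k ω)) (fun ω => (X 0 ω, Z 0 ω)) P P)
    (hA : Measurable (A β₀))
    (hmean : P[V | MeasurableSpace.comap (Z 0) inferInstance] =ᵐ[P] fun ω => μ β₀ (Z 0 ω))
    (hcenter : P[fun ω => infl₁ φ δ F (X 0 ω) | MeasurableSpace.comap (Z 0) inferInstance] =ᵐ[P]
      fun ω => (P[V | MeasurableSpace.comap (Z 0) inferInstance]) ω - φ F)
    (hF : Tendsto (fun t : ℕ × Ω => sampleMean δ X t.1 t.2) (inProb P) (𝓝 F))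
    {c : ℝ} (hδ : ∀ x, ‖δ x‖ ≤ c)
    (hm₁ : Measurable (infl₁ φ δ F))
    (hm₂ : Measurable (fun p : 𝒳 × 𝒳 => infl₂ φ δ F p.1 p.2))
    (hA2 : MemLp (fun ω => A β₀ (Z 0 ω)) 2 P)
    (hAμ2 : MemLp (fun ω => μ β₀ (Z 0 ω) • A β₀ (Z 0 ω)) 2 P)
    (hu : MemLp (fun ω => scoreFun φ δ F A μ β₀ (scoreCorr P φ δ F A β₀ X Z) (X 0 ω, Z 0 ω)) 2 P)
    (i j : Fin q) :
    sigma P φ δ F A μ β₀ X Z i j =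
      ∫ ω, scoreFun φ δ F A μ β₀ (scoreCorr P φ δ F A β₀ X Z) (X 0 ω, Z 0 ω) i
        * scoreFun φ δ F A μ β₀ (scoreCorr P φ δ F A β₀ X Z) (X 0 ω, Z 0 ω) j ∂P := by
  set u := scoreFun φ δ F A μ β₀ (scoreCorr P φ δ F A β₀ X Z) with hudef
  have hC₂ : ∀ p : 𝒳 × 𝒳, |infl₂ φ δ F p.1 p.2| ≤ _ := fun p => abs_infl₂_le hδ p.1 p.2
  have hAiν : Integrable (fun y : 𝒳 × 𝒵 => A β₀ y.2) (P.map fun ω => (X 0 ω, Z 0 ω)) :=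
    (integrable_map_measure (hA.comp measurable_snd).aestronglyMeasurable
      ((hXm 0).prodMk (hZm 0)).aemeasurable).2 (hA2.integrable one_le_two)
  have hce := condExp_kernel_smul_ae_eq hXm hZm hindep hident hm₂ hA.stronglyMeasurable hC₂ hAiν
  have hae : (fun ω => scoreVec P φ δ F A μ β₀ X Z ω) =ᵐ[P] fun ω => u (X 0 ω, Z 0 ω) := by
    filter_upwards [hce] with ω hω
    simp only [scoreVec, hudef, scoreFun, scoreCorr]
    rw [← hω]
  have hcoord : ∀ i, MemLp (fun ω => u (X 0 ω, Z 0 ω) i) 2 P := fun i =>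
    (EuclideanSpace.proj (𝕜 := ℝ) i).comp_memLp' hu
  have haei : ∀ i, (fun ω => scoreVec P φ δ F A μ β₀ X Z ω i)
      =ᵐ[P] fun ω => u (X 0 ω, Z 0 ω) i := fun i =>
    hae.mono fun ω hω => by simp only [] at hω ⊢; rw [hω]
  have hcorr0 : ∀ i, ∫ ω, scoreCorr P φ δ F A β₀ X Z (X 0 ω) i ∂P = 0 := fun i =>
    integral_kernelProj_apply_eq_zero hXm hZm hindep hident hm₂ hA.stronglyMeasurable hC₂ hAiν
      (fun x => integral_clm_comp_sub_eq_zero hXm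
        (hindep.comp (fun _ => Prod.fst) fun _ => measurable_fst)
        (fun k => (hident k).comp measurable_fst) hF hδ
        (fderiv ℝ (fderiv ℝ φ) F (δ x - F)) (hm₂.comp measurable_prodMk_left)) i
  have hfirst : ∀ i, ∫ ω, ((φ F + infl₁ φ δ F (X 0 ω) - μ β₀ (Z 0 ω)) • A β₀ (Z 0 ω)) i ∂P = 0 :=
    fun i => integral_smul_apply_eq_zero (hZm 0) (hXm 0) hmean hcenter hm₁
      (fun x => abs_infl₁_le hδ x) hA (hA2.integrable one_le_two) (hAμ2.integrable one_le_two) i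
  have hcorri : ∀ i, Integrable (fun ω => scoreCorr P φ δ F A β₀ X Z (X 0 ω) i) P := fun i =>
    (EuclideanSpace.proj (𝕜 := ℝ) i).integrable_comp (integrable_condExp.congr hce)
  have hzero : ∀ i, ∫ ω, u (X 0 ω, Z 0 ω) i ∂P = 0 := by
    intro i
    have h1 : Integrable
        (fun ω => ((φ F + infl₁ φ δ F (X 0 ω) - μ β₀ (Z 0 ω)) • A β₀ (Z 0 ω)) i) P := by
      refine (((hcoord i).integrable one_le_two).sub (hcorri i)).congr (ae_of_all _ fun ω => ?_)
      simp [hudef, scoreFun]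
    have h2 := integral_add h1 (hcorri i)
    rw [hfirst, hcorr0, add_zero] at h2
    exact h2
  rw [sigma, Matrix.of_apply, covariance_eq_sub ((hcoord i).ae_eq (haei i).symm)
    ((hcoord j).ae_eq (haei j).symm), integral_congr_ae (haei i), hzero, zero_mul, sub_zero]
  exact integral_congr_ae ((haei i).mul (haei j))

end Main

end PseudoObs

theorem theorem2 {Ω 𝒳 𝒵 D : Type*} [MeasurableSpace Ω] [MeasurableSpace 𝒳] [MeasurableSpace 𝒵]
    [NormedAddCommGroup D] [NormedSpace ℝ D] {q : ℕ}
    (P : Measure Ω) [IsProbabilityMeasure P]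
    -- the i.i.d. triplets `(V_k, X_k, Z_k)`
    (V : ℕ → Ω → ℝ) (X : ℕ → Ω → 𝒳) (Z : ℕ → Ω → 𝒵)
    (hVm : ∀ k, Measurable (V k)) (hXm : ∀ k, Measurable (X k)) (hZm : ∀ k, Measurable (Z k))
    (hindep : iIndepFun (fun k ω => (V k ω, X k ω, Z k ω)) P)
    (hident : ∀ k, IdentDistrib (fun ω => (V k ω, X k ω, Z k ω))
      (fun ω => (V 0 ω, X 0 ω, Z 0 ω)) P P)
    (hVint : Integrable (V 0) P)
    -- the parameter space, the true parameter, the mean function and the weight function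
    (Θ : Set (EuclideanSpace ℝ (Fin q))) (hΘ : IsOpen Θ)
    (β₀ : EuclideanSpace ℝ (Fin q)) (hβ₀ : β₀ ∈ Θ)
    (μ : EuclideanSpace ℝ (Fin q) → 𝒵 → ℝ)
    (A : EuclideanSpace ℝ (Fin q) → 𝒵 → EuclideanSpace ℝ (Fin q))
    (hμm : ∀ β ∈ Θ, Measurable (μ β)) (hAm : ∀ β ∈ Θ, Measurable (A β))
    -- `E(V | Z) = μ(β₀, Z)`
    (hmean : P[V 0 | MeasurableSpace.comap (Z 0) inferInstance] =ᵐ[P] fun ω => μ β₀ (Z 0 ω))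
    -- the functional, the map `x ↦ δ_x`, and the limit `F` of the sample averages
    (φ : D → ℝ) (δ : 𝒳 → D) (F : D)
    (hF : TendstoInMeasure P
      (fun (n : ℕ) ω => (n : ℝ) ^ (1 / 4 : ℝ) * ‖F - PseudoObs.sampleMean δ X n ω‖)
      atTop (fun _ => 0))
    (hδ : ∃ c : ℝ, 0 < c ∧ ∀ x, ‖δ x‖ ≤ c)
    (hφ : PseudoObs.TwiceDiffLipschitzNear φ F)
    -- the influence functions are measurable
    (hm₁ : Measurable (PseudoObs.infl₁ φ δ F))
    (hm₂ : Measurable (fun p : 𝒳 × 𝒳 => PseudoObs.infl₂ φ δ F p.1 p.2))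
    -- `E(φ̇(X) | Z) = E(V | Z) - φ(F)`
    (hcenter : P[fun ω => PseudoObs.infl₁ φ δ F (X 0 ω) |
        MeasurableSpace.comap (Z 0) inferInstance] =ᵐ[P]
      fun ω => (P[V 0 | MeasurableSpace.comap (Z 0) inferInstance]) ω - φ F)
    -- the regularity conditions
    (hAc : ∀ z, ContinuousOn (fun β => A β z) Θ)
    (hμc : ∀ z, ContinuousOn (fun β => μ β z) Θ)
    (hAdom : PseudoObs.DominatedSqIntegrableNear A (P.map (Z 0)) β₀)
    (hAμdom : PseudoObs.DominatedSqIntegrableNear (fun β z => μ β z • A β z) (P.map (Z 0)) β₀)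
    (βhat : ℕ → Ω → EuclideanSpace ℝ (Fin q))
    (hβhat : TendstoInMeasure P βhat atTop (fun _ => β₀)) :
    ∀ i j : Fin q, TendstoInMeasure P
      (fun n ω => PseudoObs.sigmaPV φ δ A μ X Z βhat n ω i j) atTop
      (fun _ => PseudoObs.sigma P φ δ F A μ β₀ X Z i j) := by
  obtain ⟨c, -, hδ⟩ := hδ
  have hsnd : Measurable fun v : ℝ × 𝒳 × 𝒵 => v.2 := measurable_snd
  have hindep' : iIndepFun (fun k ω => (X k ω, Z k ω)) P :=
    hindep.comp (fun _ v => v.2) fun _ => hsnd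
  have hident' : ∀ k, IdentDistrib (fun ω => (X k ω, Z k ω)) (fun ω => (X 0 ω, Z 0 ω)) P P :=
    fun k => (hident k).comp hsnd
  have hF' := PseudoObs.tendsto_sampleMean hF
  have hA := hAm β₀ hβ₀
  have hA2 : MemLp (fun ω => A β₀ (Z 0 ω)) 2 P :=
    (hAdom.memLp hA.aestronglyMeasurable).comp_of_map (hZm 0).aemeasurable
  have hAμm : Measurable fun z => μ β₀ z • A β₀ z := (hμm β₀ hβ₀).smul hA
  have hAμ2 : MemLp (fun ω => μ β₀ (Z 0 ω) • A β₀ (Z 0 ω)) 2 P :=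
    (hAμdom.memLp hAμm.aestronglyMeasurable).comp_of_map (hZm 0).aemeasurable
  have hpair := (hXm 0).prodMk (hZm 0)
  have := Measure.isProbabilityMeasure_map (μ := P) hpair.aemeasurable
  have hA2ν : MemLp (fun y : 𝒳 × 𝒵 => A β₀ y.2) 2 (P.map fun ω => (X 0 ω, Z 0 ω)) :=
    (memLp_map_measure_iff (hA.comp measurable_snd).aestronglyMeasurable hpair.aemeasurable).2 hA2
  have hAμ2ν : MemLp (fun y : 𝒳 × 𝒵 => μ β₀ y.2 • A β₀ y.2) 2
      (P.map fun ω => (X 0 ω, Z 0 ω)) :=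
    (memLp_map_measure_iff (hAμm.comp measurable_snd).aestronglyMeasurable
      hpair.aemeasurable).2 hAμ2
  have hcorr : StronglyMeasurable (PseudoObs.scoreCorr P φ δ F A β₀ X Z) :=
    PseudoObs.stronglyMeasurable_kernelProj hm₂ hA.stronglyMeasurable
  have hum : Measurable
      (PseudoObs.scoreFun φ δ F A μ β₀ (PseudoObs.scoreCorr P φ δ F A β₀ X Z)) :=
    ((((hm₁.comp measurable_fst).const_add (φ F)).sub
      ((hμm β₀ hβ₀).comp measurable_snd)).smul (hA.comp measurable_snd)).add
      (hcorr.measurable.comp measurable_fst)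
  have hu := (PseudoObs.memLp_scoreFun (μ := μ) hm₁ (PseudoObs.abs_infl₁_le hδ) hA2ν hAμ2ν hcorr
    (PseudoObs.norm_kernelProj_le (fun p => PseudoObs.abs_infl₂_le hδ p.1 p.2)
      (hA2ν.integrable one_le_two))).comp_of_map hpair.aemeasurable
  rw [PseudoObs.tendstoInMeasure_const_iff] at hβhat
  intro i j
  rw [PseudoObs.tendstoInMeasure_const_iff, PseudoObs.sigma_apply_eq_integral hXm hZm hindep'
    hident' hA hmean hcenter hF' hδ hm₁ hm₂ hA2 hAμ2 hu i j]
  exact PseudoObs.tendsto_sigmaPV_apply hindep' hident' hum hu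
    (PseudoObs.tendsto_avg_norm_pvTerm_sub_sq hXm hZm hindep' hident' hΘ hβ₀ hμm hAm hF' hδ hφ hm₂
      hAc hμc hAdom hAμdom hβhat) i j
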